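/- Let $G$ be an amenable discrete group, let $\varpi=\bigoplus\{\sigma:\sigma \text{ a cyclic unitary representation of } G\}$ be its universal representation on $\mathcal H$, let $C^*(G)=\overline{\operatorname{span}}^{\|\cdot\|}\,\varpi(G)$ be the full group C*-algebra, and let $W^*(G)=C^*(G)^{**}=\varpi(G)''$ be its enveloping von Neumann algebra. Let $B(G)=C^*(G)^*$ be the Fourier–Stieltjes algebra, i.e. the algebra of all matrix coefficients $s\mapsto\langle\pi(s)\xi,\eta\rangle$ of unitary representations of $G$, with the weak* topology $\sigma(B(G),C^*(G))$. The von Neumann algebra tensor product $W^*(G)\,\overline\otimes\,W^*(G)\subset B(\mathcal H\otimes\mathcal H)$ is a $B(G)$-bimodule with the actions determined by $$\langle v_1\otimes v_2,\,u\cdot a\rangle=\langle v_1\otimes (v_2u),\,a\rangle,\qquad \langle v_1\otimes v_2,\,a\cdot u\rangle=\langle (uv_1)\otimes v_2,\,a\rangle\qquad(u,v_1,v_2\in B(G)),$$ where $\langle \varpi_{\xi_1,\eta_1}\otimes\varpi_{\xi_2,\eta_2},a\rangle=\langle a(\xi_1\otimes\xi_2),\eta_1\otimes\eta_2\rangle$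 and $\varpi_{\xi,\eta}(s)=\langle\varpi(s)\xi,\eta\rangle$. Let $C_{\sigma,w}(W^*(G)\,\overline\otimes\,W^*(G))$ be the set of all $a\in W^*(G)\,\overline\otimes\,W^*(G)$ for which both maps $u\mapsto u\cdot a$ and $u\mapsto a\cdot u$ are continuous from $B(G)$ with the weak* topology to $W^*(G)\,\overline\otimes\,W^*(G)$ with its weak (Banach space) topology. Then $$C_{\sigma,w}\big(W^*(G)\,\overline\otimes\,W^*(G)\big)=C^*(G)\otimes_{\min}C^*(G),$$ where $C^*(G)\otimes_{\min}C^*(G)$ is the norm closure of $\operatorname{span}\{x\otimes y:x,y\in C^*(G)\}$ in $B(\mathcal H\otimes\mathcal H)$. -/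

import Mathlib

open scoped TensorProduct InnerProductSpace ENNReal

universe u

/-! ### Amenability of a discrete group -/

/-- A discrete group `G` is amenable if there is a left-invariant mean on `ℓ^∞(G)`: a positive
linear functional `m` with `m 1 = 1` that is invariant under all left translations. -/
def IsAmenableGroup (G : Type u) [Group G] : Prop :=
  ∃ m : lp (fun _ : G => ℝ) ∞ →ₗ[ℝ] ℝ,
    (∀ f : lp (fun _ : G => ℝ) ∞, (∀ x, 0 ≤ f x) → 0 ≤ m f) ∧
    (∀ f : lp (fun _ : G => ℝ) ∞, (∀ x, f x = 1) → m f = 1) ∧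
    (∀ (s : G) (f g : lp (fun _ : G => ℝ) ∞), (∀ x, g x = f (s⁻¹ * x)) → m g = m f)

/-! ### Operators on Hilbert spaces -/

section Operators

variable {H : Type*} [NormedAddCommGroup H] [InnerProductSpace ℂ H]

/-- The von Neumann algebra `(S ∪ S*)''` generated by a set `S` of bounded operators. -/
noncomputable def vonNeumannGenerated [CompleteSpace H] (S : Set (H →L[ℂ] H)) : VonNeumannAlgebra H :=
  VonNeumannAlgebra.commutant
    { toStarSubalgebra := StarSubalgebra.centralizer ℂ S
      centralizer_centralizer' := by
        change Set.centralizer (Set.centralizer (StarSubalgebra.centralizer ℂ S : Set (H →L[ℂ] H)))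
          = (StarSubalgebra.centralizer ℂ S : Set (H →L[ℂ] H))
        rw [StarSubalgebra.coe_centralizer, Set.centralizer_centralizer_centralizer] }

/-- The underlying linear subspace of a von Neumann algebra, with the operator norm. -/
abbrev VonNeumannAlgebra.toSubspace [CompleteSpace H] (M : VonNeumannAlgebra H) : Submodule ℂ (H →L[ℂ] H) :=
  M.toStarSubalgebra.toSubalgebra.toSubmodule

variable (H) in
/-- The Hilbert space tensor product of `H` with itself. -/
abbrev HilbertTensorSq : Type _ := UniformSpace.Completion (H ⊗[ℂ] H)

/-- The elementary tensor `ξ ⊗ η` in the Hilbert space tensor product. -/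
noncomputable def hilbertTmul (ξ η : H) : HilbertTensorSq H :=
  ((ξ ⊗ₜ[ℂ] η : H ⊗[ℂ] H) : UniformSpace.Completion (H ⊗[ℂ] H))

/-- The operator `x ⊗ y` on the Hilbert space tensor product. -/
noncomputable def opTmul (x y : H →L[ℂ] H) : HilbertTensorSq H →L[ℂ] HilbertTensorSq H :=
  (TensorProduct.mapL x y).completion

/-- `ξ ⊗ η` as a continuous linear function of `η`. -/
noncomputable def hilbertTmulL (ξ : H) : H →L[ℂ] HilbertTensorSq H :=
  (UniformSpace.Completion.toComplL (𝕜 := ℂ) (E := H ⊗[ℂ] H)).comp (TensorProduct.mkL ℂ H H ξ)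

theorem hilbertTmulL_apply (ξ η : H) : hilbertTmulL ξ η = hilbertTmul ξ η := rfl

/-- `ξ ⊗ η` as a continuous linear function of `ξ`. -/
noncomputable def hilbertTmulR (η : H) : H →L[ℂ] HilbertTensorSq H :=
  (UniformSpace.Completion.toComplL (𝕜 := ℂ) (E := H ⊗[ℂ] H)).comp
    ((TensorProduct.mkL ℂ H H).flip η)

theorem hilbertTmulR_apply (ξ η : H) : hilbertTmulR η ξ = hilbertTmul ξ η := rfl

/-- A bounded operator on the Hilbert space tensor product is determined by its matrix
coefficients at elementary tensors. -/
theorem op_ext_hilbertTmul (S T : HilbertTensorSq H →L[ℂ] HilbertTensorSq H)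
    (h : ∀ ξ₁ ξ₂ η₁ η₂ : H, ⟪hilbertTmul η₁ η₂, S (hilbertTmul ξ₁ ξ₂)⟫_ℂ =
      ⟪hilbertTmul η₁ η₂, T (hilbertTmul ξ₁ ξ₂)⟫_ℂ) : S = T := by
  have ext1 : ∀ U V : HilbertTensorSq H →L[ℂ] HilbertTensorSq H,
      (∀ ξ₁ ξ₂, U (hilbertTmul ξ₁ ξ₂) = V (hilbertTmul ξ₁ ξ₂)) → U = V := by
    intro U V hUV
    ext x
    induction x using UniformSpace.Completion.induction_on with
    | hp => exact isClosed_eq U.continuous V.continuous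
    | ih x =>
      induction x using TensorProduct.induction_on with
      | zero => rw [UniformSpace.Completion.coe_zero, map_zero, map_zero]
      | tmul x y => exact hUV x y
      | add x y hx hy => rw [UniformSpace.Completion.coe_add, map_add, map_add, hx, hy]
  have ext2 : ∀ x y : HilbertTensorSq H,
      (∀ η₁ η₂, ⟪hilbertTmul η₁ η₂, x⟫_ℂ = ⟪hilbertTmul η₁ η₂, y⟫_ℂ) → x = y := by
    intro x y hxy
    refine ext_inner_left ℂ fun z => ?_
    induction z using UniformSpace.Completion.induction_on with
    | hp => exact isClosed_eq (by fun_prop) (by fun_prop)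
    | ih z =>
      induction z using TensorProduct.induction_on with
      | zero => rw [UniformSpace.Completion.coe_zero, inner_zero_left, inner_zero_left]
      | tmul u v => exact hxy u v
      | add u v hu hv =>
        rw [UniformSpace.Completion.coe_add, inner_add_left, inner_add_left, hu, hv]
  exact ext1 S T fun ξ₁ ξ₂ => ext2 _ _ fun η₁ η₂ => h ξ₁ ξ₂ η₁ η₂

theorem opTmul_hilbertTmul (x y : H →L[ℂ] H) (ξ η : H) :
    opTmul x y (hilbertTmul ξ η) = hilbertTmul (x ξ) (y η) := by
  simp [opTmul, hilbertTmul]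

end Operators

/-! ### Unitary representations and the universal representation -/

/-- A cyclic unitary representation of the discrete group `G`. -/
structure CyclicRep (G : Type u) [Group G] : Type (u + 1) where
  /-- the underlying Hilbert space -/
  space : Type u
  [normed : NormedAddCommGroup space]
  [inner : InnerProductSpace ℂ space]
  [complete : CompleteSpace space]
  /-- the unitary representation -/
  rep : G →* (space ≃ₗᵢ[ℂ] space)
  cyclic : ∃ ξ : space,
    (Submodule.span ℂ (Set.range fun s : G => rep s ξ)).topologicalClosure = ⊤

attribute [instance] CyclicRep.normed CyclicRep.inner CyclicRep.complete

section Universal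

variable (G : Type u) [Group G]

/-- The Hilbert space of the universal representation: the Hilbert space direct sum of all cyclic
representations.  (Every cyclic representation of `G : Type u` has a unitarily equivalent copy
in `Type u`; occurrences of several equivalent copies only change the multiplicity.) -/
abbrev UnivSpace : Type (u + 1) := lp (fun σ : CyclicRep G => σ.space) 2

variable {G}

theorem memℓp_rep (s : G) (f : UnivSpace G) :
    Memℓp (fun σ : CyclicRep G => σ.rep s (f σ)) 2 := by
  have hf := lp.memℓp f
  rw [memℓp_gen_iff (by norm_num)] at hf ⊢
  simpa using hf

/-- The operator of the universal representation at `s`, as a linear isometry. -/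
noncomputable def univIsometry (s : G) : UnivSpace G →ₗᵢ[ℂ] UnivSpace G where
  toFun f := ⟨fun σ => σ.rep s (f σ), memℓp_rep s f⟩
  map_add' f g := by ext σ; exact (σ.rep s).map_add (f σ) (g σ)
  map_smul' c f := by ext σ; exact (σ.rep s).map_smul c (f σ)
  norm_map' f := by
    simp only [LinearMap.coe_mk, AddHom.coe_mk]
    rw [lp.norm_eq_tsum_rpow (by norm_num), lp.norm_eq_tsum_rpow (by norm_num)]
    simp

theorem univIsometry_apply (s : G) (f : UnivSpace G) (σ : CyclicRep G) :
    univIsometry s f σ = σ.rep s (f σ) := rfl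

variable (G) in
/-- The universal representation `ϖ = ⊕ {σ : σ a cyclic unitary representation of G}`. -/
noncomputable def univRep : G →* (UnivSpace G ≃ₗᵢ[ℂ] UnivSpace G) where
  toFun s :=
    { toLinearEquiv := LinearEquiv.ofLinearMap (univIsometry s).toLinearMap
        (univIsometry s⁻¹).toLinearMap
        (by ext f σ; simp [univIsometry_apply])
        (by ext f σ; simp [univIsometry_apply])
      norm_map' := (univIsometry s).norm_map }
  map_one' := by
    ext f σ
    change univIsometry 1 f σ = f σ
    simp [univIsometry_apply]
  map_mul' s t := by
    ext f σ
    change univIsometry (s * t) f σ = univIsometry s (univIsometry t f) σ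
    simp [univIsometry_apply]

theorem univRep_apply (s : G) (f : UnivSpace G) (σ : CyclicRep G) :
    univRep G s f σ = σ.rep s (f σ) := rfl

/-- The unitary `ϖ(s)` as a bounded operator. -/
noncomputable def univOp (s : G) : UnivSpace G →L[ℂ] UnivSpace G :=
  ((univRep G s).toContinuousLinearEquiv : UnivSpace G →L[ℂ] UnivSpace G)

theorem univOp_apply (s : G) (f : UnivSpace G) : univOp s f = univRep G s f := rfl

variable (G)

/-- The full group C*-algebra `C*(G)`: the norm closed linear span of `ϖ(G)`. -/
noncomputable def fullCStar : Submodule ℂ (UnivSpace G →L[ℂ] UnivSpace G) :=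
  (Submodule.span ℂ (Set.range (univOp (G := G)))).topologicalClosure

/-- The von Neumann algebra `W*(G)`, the enveloping von Neumann algebra `ϖ(G)''` of `C*(G)`. -/
noncomputable def groupWStar : VonNeumannAlgebra (UnivSpace G) :=
  vonNeumannGenerated (Set.range (univOp (G := G)))

/-- The von Neumann algebra tensor product of `W*(G)` with itself. -/
noncomputable def wStarTensor : VonNeumannAlgebra (HilbertTensorSq (UnivSpace G)) :=
  vonNeumannGenerated {T | ∃ x ∈ groupWStar G, ∃ y ∈ groupWStar G, T = opTmul x y}

/-- The minimal (spatial) tensor product of `C*(G)` with itself. -/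
noncomputable def minTensor :
    Submodule ℂ (HilbertTensorSq (UnivSpace G) →L[ℂ] HilbertTensorSq (UnivSpace G)) :=
  (Submodule.span ℂ
    {T | ∃ x ∈ fullCStar G, ∃ y ∈ fullCStar G, T = opTmul x y}).topologicalClosure

variable {G}

theorem univOp_mem_fullCStar (s : G) : univOp s ∈ fullCStar G :=
  Submodule.le_topologicalClosure _ (Submodule.subset_span ⟨s, rfl⟩)

end Universal

/-! ### The Fourier–Stieltjes algebra -/

section FourierStieltjes

variable (G : Type u) [Group G]

/-- `u` is a matrix coefficient `s ↦ ⟨π(s)ξ, η⟩` of some unitary representation `π` of `G`.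
(Mathlib's inner product is linear in the second variable.) -/
def IsMatrixCoefficient {G : Type u} [Group G] (v : G → ℂ) : Prop :=
  ∃ (K : Type u) (_ : NormedAddCommGroup K) (_ : InnerProductSpace ℂ K) (_ : CompleteSpace K)
    (π : G →* (K ≃ₗᵢ[ℂ] K)) (ξ η : K), ∀ s, v s = ⟪η, π s ξ⟫_ℂ

/-- The Fourier–Stieltjes algebra `B(G)`, the set of all matrix coefficients. -/
def FourierStieltjes : Type u := {v : G → ℂ // IsMatrixCoefficient v}

instance : CoeFun (FourierStieltjes G) (fun _ => G → ℂ) := ⟨fun v => v.1⟩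

variable {G}

/-- The restriction of a unitary representation to the cyclic subspace generated by `ξ`. -/
theorem exists_cyclicRep {K : Type u} [NormedAddCommGroup K] [InnerProductSpace ℂ K]
    [CompleteSpace K] (π : G →* (K ≃ₗᵢ[ℂ] K)) (ξ : K) :
    ∃ (σ : CyclicRep G) (V : σ.space →ₗᵢ[ℂ] K) (ξ₀ : σ.space),
      V ξ₀ = ξ ∧ ∀ s x, V (σ.rep s x) = π s (V x) := by
  set M₀ : Submodule ℂ K := Submodule.span ℂ (Set.range fun s : G => π s ξ) with hM₀
  set M : Submodule ℂ K := M₀.topologicalClosure with hM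
  have hinv : ∀ s : G, ∀ x ∈ M, π s x ∈ M := by
    intro s x hx
    have h0 : ∀ y ∈ M₀, π s y ∈ M₀ := by
      intro y hy
      induction hy using Submodule.span_induction with
      | mem y hy =>
        obtain ⟨t, rfl⟩ := hy
        refine Submodule.subset_span ⟨s * t, ?_⟩
        simp
      | zero => simp
      | add x y _ _ hx hy => simpa using add_mem hx hy
      | smul c x _ hx => simpa using Submodule.smul_mem _ c hx
    exact map_mem_closure (π s).continuous hx h0
  let R : G → (M ≃ₗᵢ[ℂ] M) := fun s =>
    { toLinearEquiv := LinearEquiv.ofLinearMap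
        ((π s).toLinearEquiv.toLinearMap.restrict (hinv s))
        ((π s⁻¹).toLinearEquiv.toLinearMap.restrict (hinv s⁻¹))
        (by ext x; simp [LinearMap.restrict_apply])
        (by ext x; simp [LinearMap.restrict_apply])
      norm_map' := fun x => (π s).norm_map x }
  have hR : ∀ s (x : M), ((R s x : M) : K) = π s x := fun s x => rfl
  let ρ : G →* (M ≃ₗᵢ[ℂ] M) :=
    { toFun := R
      map_one' := by ext x; simp [hR]
      map_mul' := fun s t => by ext x; simp [hR] }
  have hξ : ξ ∈ M :=
    Submodule.le_topologicalClosure _ (Submodule.subset_span ⟨1, by simp⟩)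
  have : CompleteSpace M := (Submodule.isClosed_topologicalClosure M₀).completeSpace_coe
  refine ⟨{ space := M, rep := ρ, cyclic := ⟨⟨ξ, hξ⟩, ?_⟩ }, M.subtypeₗᵢ, ⟨ξ, hξ⟩, rfl,
    fun s x => rfl⟩
  rw [eq_top_iff]
  rintro ⟨x, hx⟩ -
  set N₀ : Submodule ℂ M := Submodule.span ℂ (Set.range fun s : G => ρ s ⟨ξ, hξ⟩) with hN₀
  change (⟨x, hx⟩ : M) ∈ closure (N₀ : Set M)
  have himg : Submodule.map M.subtype N₀ = M₀ := by
    rw [hN₀, Submodule.map_span, hM₀, ← Set.range_comp]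
    rfl
  rw [Topology.IsInducing.subtypeVal.closure_eq_preimage_closure_image]
  change x ∈ closure ((fun y : M => (y : K)) '' (N₀ : Set M))
  have : (fun y : M => (y : K)) '' (N₀ : Set M) = (M₀ : Set K) := by
    rw [← himg]; rfl
  rw [this]
  exact hx

section Tensor

variable {K K' : Type u} [NormedAddCommGroup K] [InnerProductSpace ℂ K]
  [NormedAddCommGroup K'] [InnerProductSpace ℂ K']

/-- The operator `π(s) ⊗ ρ(s)` on the Hilbert space tensor product, as a linear isometry. -/
noncomputable def tensorRepIsometry (π : G →* (K ≃ₗᵢ[ℂ] K)) (ρ : G →* (K' ≃ₗᵢ[ℂ] K')) (s : G) :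
    UniformSpace.Completion (K ⊗[ℂ] K') →ₗᵢ[ℂ] UniformSpace.Completion (K ⊗[ℂ] K') where
  toLinearMap := ((TensorProduct.congrIsometry (π s) (ρ s)).toLinearIsometry
    |>.toContinuousLinearMap.completion).toLinearMap
  norm_map' x := by
    induction x using UniformSpace.Completion.induction_on with
    | hp => exact isClosed_eq (by simpa using (ContinuousLinearMap.continuous _).norm) (by fun_prop)
    | ih x =>
      change ‖ContinuousLinearMap.completion _ _‖ = _
      rw [ContinuousLinearMap.completion_apply_coe, UniformSpace.Completion.norm_coe,
        UniformSpace.Completion.norm_coe]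
      exact (TensorProduct.congrIsometry (π s) (ρ s)).norm_map x

theorem tensorRepIsometry_coe (π : G →* (K ≃ₗᵢ[ℂ] K)) (ρ : G →* (K' ≃ₗᵢ[ℂ] K')) (s : G)
    (x : K ⊗[ℂ] K') :
    tensorRepIsometry π ρ s (x : UniformSpace.Completion (K ⊗[ℂ] K')) =
      (TensorProduct.congrIsometry (π s) (ρ s) x : K ⊗[ℂ] K') :=
  ContinuousLinearMap.completion_apply_coe _ _

theorem tensorRepIsometry_one (π : G →* (K ≃ₗᵢ[ℂ] K)) (ρ : G →* (K' ≃ₗᵢ[ℂ] K'))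
    (x : UniformSpace.Completion (K ⊗[ℂ] K')) : tensorRepIsometry π ρ 1 x = x := by
  induction x using UniformSpace.Completion.induction_on with
  | hp => exact isClosed_eq (tensorRepIsometry π ρ 1).continuous continuous_id
  | ih x =>
    rw [tensorRepIsometry_coe]
    congr 1
    induction x using TensorProduct.induction_on with
    | zero => simp
    | tmul x y =>
      rw [TensorProduct.congrIsometry_apply, TensorProduct.congr_tmul, map_one, map_one]
      rfl
    | add x y hx hy => rw [map_add, hx, hy]

theorem tensorRepIsometry_mul (π : G →* (K ≃ₗᵢ[ℂ] K)) (ρ : G →* (K' ≃ₗᵢ[ℂ] K')) (s t : G)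
    (x : UniformSpace.Completion (K ⊗[ℂ] K')) :
    tensorRepIsometry π ρ (s * t) x =
      tensorRepIsometry π ρ s (tensorRepIsometry π ρ t x) := by
  induction x using UniformSpace.Completion.induction_on with
  | hp =>
    exact isClosed_eq (tensorRepIsometry π ρ (s * t)).continuous
      ((tensorRepIsometry π ρ s).continuous.comp (tensorRepIsometry π ρ t).continuous)
  | ih x =>
    rw [tensorRepIsometry_coe, tensorRepIsometry_coe, tensorRepIsometry_coe]
    congr 1
    induction x using TensorProduct.induction_on with
    | zero => simp
    | tmul x y =>
      simp only [TensorProduct.congrIsometry_apply, TensorProduct.congr_tmul, map_mul]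
      rfl
    | add x y hx hy => rw [map_add, map_add, map_add, hx, hy]

/-- The inner tensor product of two unitary representations. -/
noncomputable def tensorRep (π : G →* (K ≃ₗᵢ[ℂ] K)) (ρ : G →* (K' ≃ₗᵢ[ℂ] K')) :
    G →* (UniformSpace.Completion (K ⊗[ℂ] K') ≃ₗᵢ[ℂ] UniformSpace.Completion (K ⊗[ℂ] K')) where
  toFun s :=
    { toLinearEquiv := LinearEquiv.ofLinearMap (tensorRepIsometry π ρ s).toLinearMap
        (tensorRepIsometry π ρ s⁻¹).toLinearMap
        (by
          refine LinearMap.ext fun x => ?_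
          change tensorRepIsometry π ρ s (tensorRepIsometry π ρ s⁻¹ x) = x
          rw [← tensorRepIsometry_mul, mul_inv_cancel, tensorRepIsometry_one])
        (by
          refine LinearMap.ext fun x => ?_
          change tensorRepIsometry π ρ s⁻¹ (tensorRepIsometry π ρ s x) = x
          rw [← tensorRepIsometry_mul, inv_mul_cancel, tensorRepIsometry_one])
      norm_map' := (tensorRepIsometry π ρ s).norm_map }
  map_one' := LinearIsometryEquiv.ext fun x => tensorRepIsometry_one π ρ x
  map_mul' s t := LinearIsometryEquiv.ext fun x => tensorRepIsometry_mul π ρ s t x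

end Tensor

/-- `B(G)` is closed under pointwise multiplication. -/
theorem IsMatrixCoefficient.mul {v w : G → ℂ} (hv : IsMatrixCoefficient v)
    (hw : IsMatrixCoefficient w) : IsMatrixCoefficient (v * w) := by
  obtain ⟨K, _, _, _, π, ξ, η, hv⟩ := hv
  obtain ⟨K', _, _, _, ρ, ξ', η', hw⟩ := hw
  refine ⟨UniformSpace.Completion (K ⊗[ℂ] K'), inferInstance, inferInstance, inferInstance,
    tensorRep π ρ, ((ξ ⊗ₜ[ℂ] ξ' : K ⊗[ℂ] K') : UniformSpace.Completion (K ⊗[ℂ] K')),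
    ((η ⊗ₜ[ℂ] η' : K ⊗[ℂ] K') : UniformSpace.Completion (K ⊗[ℂ] K')), fun s => ?_⟩
  change _ = ⟪_, tensorRepIsometry π ρ s _⟫_ℂ
  rw [tensorRepIsometry_coe, UniformSpace.Completion.inner_coe]
  simp [hv, hw]

noncomputable instance : Mul (FourierStieltjes G) := ⟨fun v w => ⟨v.1 * w.1, v.2.mul w.2⟩⟩

theorem FourierStieltjes.mul_apply (v w : FourierStieltjes G) (s : G) : (v * w) s = v s * w s := rfl

/-- Every element of `B(G)` is a matrix coefficient of the universal representation. -/
theorem FourierStieltjes.exists_univ (v : FourierStieltjes G) :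
    ∃ ξ η : UnivSpace G, ∀ s, v s = ⟪η, univOp s ξ⟫_ℂ := by
  classical
  obtain ⟨v, K, _, _, _, π, ξ, η, hv⟩ := v
  obtain ⟨σ, V, ξ₀, hξ, hV⟩ := exists_cyclicRep π ξ
  refine ⟨lp.single 2 σ ξ₀, lp.single 2 σ (ContinuousLinearMap.adjoint V.toContinuousLinearMap η),
    fun s => ?_⟩
  rw [lp.inner_single_left, univOp_apply, univRep_apply, lp.single_apply_self,
    ContinuousLinearMap.adjoint_inner_left]
  change v s = ⟪η, V (σ.rep s ξ₀)⟫_ℂ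
  rw [hV, hξ]
  exact hv s

/-- The duality between `B(G)` and `C*(G)`: every `v ∈ B(G)` extends uniquely to a bounded linear
functional on `C*(G)` with value `v(s)` at `ϖ(s)`. -/
theorem FourierStieltjes.existsUnique_dual (v : FourierStieltjes G) :
    ∃! φ : StrongDual ℂ (fullCStar G), ∀ s, φ ⟨univOp s, univOp_mem_fullCStar s⟩ = v s := by
  obtain ⟨ξ, η, h⟩ := v.exists_univ
  refine ⟨((innerSL ℂ η).comp (ContinuousLinearMap.apply ℂ (UnivSpace G) ξ)).comp
    (fullCStar G).subtypeL, fun s => (h s).symm, ?_⟩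
  intro ψ hψ
  have key : ∀ χ₁ χ₂ : StrongDual ℂ (fullCStar G),
      (∀ s, χ₁ ⟨univOp s, univOp_mem_fullCStar s⟩ = χ₂ ⟨univOp s, univOp_mem_fullCStar s⟩) →
      χ₁ = χ₂ := by
    intro χ₁ χ₂ hχ
    set S : Submodule ℂ (UnivSpace G →L[ℂ] UnivSpace G) :=
      Submodule.span ℂ (Set.range (univOp (G := G))) with hS
    have hspan : ∀ a (ha : a ∈ S), χ₁ ⟨a, Submodule.le_topologicalClosure _ ha⟩ =
        χ₂ ⟨a, Submodule.le_topologicalClosure _ ha⟩ := by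
      intro a ha
      induction ha using Submodule.span_induction with
      | mem a ha => obtain ⟨s, rfl⟩ := ha; exact hχ s
      | zero => exact (map_zero χ₁).trans (map_zero χ₂).symm
      | add a b ha hb iha ihb =>
        exact (map_add χ₁ _ _).trans ((congrArg₂ (· + ·) iha ihb).trans (map_add χ₂ _ _).symm)
      | smul c a ha iha =>
        exact (map_smul χ₁ c _).trans ((congrArg (c • ·) iha).trans (map_smul χ₂ c _).symm)
    ext ⟨a, ha⟩
    have hcl : (⟨a, ha⟩ : fullCStar G) ∈ closure {x : fullCStar G | x.1 ∈ S} := by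
      rw [Topology.IsInducing.subtypeVal.closure_eq_preimage_closure_image]
      refine closure_mono ?_ ha
      intro b hb
      exact ⟨⟨b, Submodule.le_topologicalClosure _ hb⟩, hb, rfl⟩
    have hclosed : IsClosed {x : fullCStar G | χ₁ x = χ₂ x} :=
      isClosed_eq χ₁.continuous χ₂.continuous
    exact closure_minimal (fun x hx => hspan x.1 hx) hclosed hcl
  exact key _ _ fun s => (hψ s).trans (h s)

/-- The element of the dual of `C*(G)` corresponding to `v ∈ B(G)`. -/
noncomputable def FourierStieltjes.toDual (v : FourierStieltjes G) : StrongDual ℂ (fullCStar G) :=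
  v.existsUnique_dual.choose

theorem FourierStieltjes.toDual_apply (v : FourierStieltjes G) (s : G) :
    v.toDual ⟨univOp s, univOp_mem_fullCStar s⟩ = v s :=
  v.existsUnique_dual.choose_spec.1 s

/-- `B(G)` carries the weak* topology `σ(B(G), C*(G))`. -/
noncomputable instance : TopologicalSpace (FourierStieltjes G) :=
  TopologicalSpace.induced (fun v (a : fullCStar G) => v.toDual a) inferInstance

end FourierStieltjes

/-! ### The `B(G)`-bimodule `W*(G) ⊗ W*(G)` and the space `C_{σ,w}`

`W*(G) ⊗ W*(G)` is the dual of the projective tensor product of `B(G)` with itself; for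
`v₁ = ϖ_{ξ₁,η₁}` and `v₂ = ϖ_{ξ₂,η₂}` in `B(G)` the pairing is
`⟨v₁ ⊗ v₂, a⟩ = ⟨a (ξ₁ ⊗ ξ₂), η₁ ⊗ η₂⟩`. The module actions are the dual ones,
`⟨v₁ ⊗ v₂, w · a⟩ = ⟨v₁ ⊗ (v₂ w), a⟩` and `⟨v₁ ⊗ v₂, a · w⟩ = ⟨(w v₁) ⊗ v₂, a⟩`. -/

section Bimodule

variable {G : Type u} [Group G]

/-- `b = w · a`: whenever `v₂ = ϖ_{ξ₂,η₂}` and `v₂ w = ϖ_{ξ₂',η₂'}`, one has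
`⟨v₁ ⊗ v₂, b⟩ = ⟨v₁ ⊗ (v₂ w), a⟩` for all `v₁ = ϖ_{ξ₁,η₁}`. -/
def IsLeftAction (w : FourierStieltjes G) (a b : (wStarTensor G).toSubspace) : Prop :=
  ∀ ξ₁ η₁ ξ₂ η₂ ξ₂' η₂' : UnivSpace G,
    (∀ s, ⟪η₂', univOp s ξ₂'⟫_ℂ = ⟪η₂, univOp s ξ₂⟫_ℂ * w s) →
    ⟪hilbertTmul η₁ η₂, b.1 (hilbertTmul ξ₁ ξ₂)⟫_ℂ =
      ⟪hilbertTmul η₁ η₂', a.1 (hilbertTmul ξ₁ ξ₂')⟫_ℂ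

/-- `b = a · w`: whenever `v₁ = ϖ_{ξ₁,η₁}` and `w v₁ = ϖ_{ξ₁',η₁'}`, one has
`⟨v₁ ⊗ v₂, b⟩ = ⟨(w v₁) ⊗ v₂, a⟩` for all `v₂ = ϖ_{ξ₂,η₂}`. -/
def IsRightAction (w : FourierStieltjes G) (a b : (wStarTensor G).toSubspace) : Prop :=
  ∀ ξ₁ η₁ ξ₂ η₂ ξ₁' η₁' : UnivSpace G,
    (∀ s, ⟪η₁', univOp s ξ₁'⟫_ℂ = w s * ⟪η₁, univOp s ξ₁⟫_ℂ) →
    ⟪hilbertTmul η₁ η₂, b.1 (hilbertTmul ξ₁ ξ₂)⟫_ℂ =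
      ⟪hilbertTmul η₁' η₂, a.1 (hilbertTmul ξ₁' ξ₂)⟫_ℂ

/-- For `ξ` and `η` in single summands of the universal representation, `ϖ_{ξ,η} w` is again a
coefficient of the universal representation. -/
theorem exists_mul_univ [DecidableEq (CyclicRep G)] (w : FourierStieltjes G) (σ τ : CyclicRep G)
    (x : σ.space) (y : τ.space) : ∃ ξ' η' : UnivSpace G, ∀ s,
      ⟪η', univOp s ξ'⟫_ℂ =
        ⟪(lp.single 2 τ y : UnivSpace G), univOp s (lp.single 2 σ x : UnivSpace G)⟫_ℂ * w s := by
  by_cases h : τ = σ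
  · subst h
    let v : FourierStieltjes G := ⟨fun s => ⟪y, τ.rep s x⟫_ℂ, τ.space, inferInstance,
      inferInstance, inferInstance, τ.rep, x, y, fun _ => rfl⟩
    obtain ⟨ξ', η', hv⟩ := (v * w).exists_univ
    refine ⟨ξ', η', fun s => ?_⟩
    rw [← hv, FourierStieltjes.mul_apply, lp.inner_single_left, univOp_apply, univRep_apply,
      lp.single_apply_self]
  · refine ⟨0, 0, fun s => ?_⟩
    have h0 : univOp s (lp.single 2 σ x : UnivSpace G) τ = 0 := by
      rw [univOp_apply, univRep_apply, lp.single_apply_ne _ _ _ h, map_zero]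
    rw [lp.inner_single_left, h0, inner_zero_left, inner_zero_right, zero_mul]

/-- Two operators agree if their matrix coefficients agree at elementary tensors whose second
factors lie in single summands of the universal representation. -/
theorem op_ext_single_right [DecidableEq (CyclicRep G)]
    (S T : HilbertTensorSq (UnivSpace G) →L[ℂ] HilbertTensorSq (UnivSpace G))
    (h : ∀ (ξ₁ η₁ : UnivSpace G) (σ τ : CyclicRep G) (x : σ.space) (y : τ.space),
      ⟪hilbertTmul η₁ (lp.single 2 τ y), S (hilbertTmul ξ₁ (lp.single 2 σ x))⟫_ℂ =
        ⟪hilbertTmul η₁ (lp.single 2 τ y), T (hilbertTmul ξ₁ (lp.single 2 σ x))⟫_ℂ) : S = T := by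
  have step : ∀ (U : HilbertTensorSq (UnivSpace G)) (η₁ : UnivSpace G),
      (∀ (τ : CyclicRep G) (y : τ.space), ⟪U, hilbertTmul η₁ (lp.single 2 τ y)⟫_ℂ = 0) →
      ∀ η₂, ⟪U, hilbertTmul η₁ η₂⟫_ℂ = 0 := by
    intro U η₁ hU η₂
    have : (innerSL ℂ U).comp (hilbertTmulL η₁) = 0 :=
      lp.ext_continuousLinearMap (by norm_num) fun τ => by
        ext y
        exact hU τ y
    exact congrArg (fun f => f η₂) this
  refine op_ext_hilbertTmul S T fun ξ₁ ξ₂ η₁ η₂ => ?_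
  have key : ∀ (σ : CyclicRep G) (x : σ.space) (η₂ : UnivSpace G),
      ⟪hilbertTmul η₁ η₂, (S - T) (hilbertTmul ξ₁ (lp.single 2 σ x))⟫_ℂ = 0 := by
    intro σ x η₂
    rw [inner_eq_zero_symm]
    refine step _ η₁ (fun τ y => ?_) η₂
    rw [inner_eq_zero_symm, sub_apply, inner_sub_right, h, sub_self]
  have : (innerSL ℂ (hilbertTmul η₁ η₂)).comp ((S - T).comp (hilbertTmulL ξ₁)) = 0 :=
    lp.ext_continuousLinearMap (by norm_num) fun σ => by
      ext x
      exact key σ x η₂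
  have h0 : ⟪hilbertTmul η₁ η₂, (S - T) (hilbertTmul ξ₁ ξ₂)⟫_ℂ = 0 :=
    congrArg (fun f => f ξ₂) this
  rwa [sub_apply, inner_sub_right, sub_eq_zero] at h0

/-- `w · a` is uniquely determined. -/
theorem IsLeftAction.unique {w : FourierStieltjes G} {a b b' : (wStarTensor G).toSubspace}
    (hb : IsLeftAction w a b) (hb' : IsLeftAction w a b') : b = b' := by
  classical
  refine Subtype.ext (op_ext_single_right _ _ fun ξ₁ η₁ σ τ x y => ?_)
  obtain ⟨ξ', η', h⟩ := exists_mul_univ w σ τ x y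
  exact (hb _ _ _ _ _ _ h).trans (hb' _ _ _ _ _ _ h).symm

/-- Two operators agree if their matrix coefficients agree at elementary tensors whose first
factors lie in single summands of the universal representation. -/
theorem op_ext_single_left [DecidableEq (CyclicRep G)]
    (S T : HilbertTensorSq (UnivSpace G) →L[ℂ] HilbertTensorSq (UnivSpace G))
    (h : ∀ (ξ₂ η₂ : UnivSpace G) (σ τ : CyclicRep G) (x : σ.space) (y : τ.space),
      ⟪hilbertTmul (lp.single 2 τ y) η₂, S (hilbertTmul (lp.single 2 σ x) ξ₂)⟫_ℂ =
        ⟪hilbertTmul (lp.single 2 τ y) η₂, T (hilbertTmul (lp.single 2 σ x) ξ₂)⟫_ℂ) : S = T := by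
  have step : ∀ (U : HilbertTensorSq (UnivSpace G)) (η₂ : UnivSpace G),
      (∀ (τ : CyclicRep G) (y : τ.space), ⟪U, hilbertTmul (lp.single 2 τ y) η₂⟫_ℂ = 0) →
      ∀ η₁, ⟪U, hilbertTmul η₁ η₂⟫_ℂ = 0 := by
    intro U η₂ hU η₁
    have : (innerSL ℂ U).comp (hilbertTmulR η₂) = 0 :=
      lp.ext_continuousLinearMap (by norm_num) fun τ => by
        ext y
        exact hU τ y
    exact congrArg (fun f => f η₁) this
  refine op_ext_hilbertTmul S T fun ξ₁ ξ₂ η₁ η₂ => ?_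
  have key : ∀ (σ : CyclicRep G) (x : σ.space) (η₁ : UnivSpace G),
      ⟪hilbertTmul η₁ η₂, (S - T) (hilbertTmul (lp.single 2 σ x) ξ₂)⟫_ℂ = 0 := by
    intro σ x η₁
    rw [inner_eq_zero_symm]
    refine step _ η₂ (fun τ y => ?_) η₁
    rw [inner_eq_zero_symm, sub_apply, inner_sub_right, h, sub_self]
  have : (innerSL ℂ (hilbertTmul η₁ η₂)).comp ((S - T).comp (hilbertTmulR ξ₂)) = 0 :=
    lp.ext_continuousLinearMap (by norm_num) fun σ => by
      ext x
      exact key σ x η₁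
  have h0 : ⟪hilbertTmul η₁ η₂, (S - T) (hilbertTmul ξ₁ ξ₂)⟫_ℂ = 0 :=
    congrArg (fun f => f ξ₁) this
  rwa [sub_apply, inner_sub_right, sub_eq_zero] at h0

/-- `a · w` is uniquely determined. -/
theorem IsRightAction.unique {w : FourierStieltjes G} {a b b' : (wStarTensor G).toSubspace}
    (hb : IsRightAction w a b) (hb' : IsRightAction w a b') : b = b' := by
  classical
  refine Subtype.ext (op_ext_single_left _ _ fun ξ₂ η₂ σ τ x y => ?_)
  obtain ⟨ξ', η', h⟩ := exists_mul_univ w σ τ x y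
  have h' := fun s => (h s).trans (mul_comm _ _)
  exact (hb _ _ _ _ _ _ h').trans (hb' _ _ _ _ _ _ h').symm

variable (G) in
/-- `C_{σ,w}` of the `B(G)`-bimodule `W*(G) ⊗ W*(G)`: all `a` whose orbit maps `w ↦ w · a` and
`w ↦ a · w` are continuous from the weak* topology of `B(G)` to the weak topology (given by all
bounded linear functionals) of the Banach space `W*(G) ⊗ W*(G)`. -/
def cSigmaW : Set (wStarTensor G).toSubspace :=
  {a | ∃ L R : FourierStieltjes G → (wStarTensor G).toSubspace,
    (∀ w, IsLeftAction w a (L w)) ∧ (∀ w, IsRightAction w a (R w)) ∧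
    Continuous (fun w => toWeakSpace ℂ (wStarTensor G).toSubspace (L w)) ∧
    Continuous (fun w => toWeakSpace ℂ (wStarTensor G).toSubspace (R w))}

end Bimodule

/-! ### Closed spans and bounded relations -/

section Closure

variable {E F : Type*} [NormedAddCommGroup E] [NormedSpace ℂ E] [NormedAddCommGroup F]
  [NormedSpace ℂ F]

/-! The inclusion of the minimal tensor product in `cSigmaW G` does not depend on amenability. For p
either coordinate projection of G × G, the map ϖ(s) ⊗ ϖ(t) ↦ ϖ(s) ⊗ ϖ(t) ⊗ ϖ(p(s,t)) extends
contractively to the minimal tensor product: a product of vector states of ϖ is again a vector state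
of ϖ, so the larger representation is weakly contained in ϖ ⊗ ϖ (`norm_le_of_vectorStates`,
`norm_snd_le_of_mem_span_cmap`). Let θ be the image of a. Slicing the third leg of θ by a vector
functional representing w gives w · a for p = snd and a · w for p = fst. A bounded functional F
applied to this slice is the pairing of w with (F ⊗ id)(θ), an element of C*(G)
(`exists_operator_of_slices`). Hence the orbit maps are weak*-to-weak continuous.

For the converse, amenability gives finitely supported w_i in B(G) tending weak* to 1: Reiter's
condition, then coefficients of almost invariant vectors of the regular representation
(`IsAmenableGroup.exists_tendsto_one`). For w of finite support, w · a is a finite sum of terms x_t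
⊗ ϖ(t) and a · w is a finite sum of terms ϖ(t) ⊗ y_t, where y_t is a left slice of a
(`IsLeftAction.eq_sum`, `IsRightAction.eq_sum`). This rests on two facts: slices of a lie in W*(G),
and a vector functional on W*(G) is determined by its values on ϖ(G)
(`inner_eq_of_mem_vonNeumannGenerated`). Closed subspaces are weakly closed, so w_i · a → a puts a
in the closed span of all x ⊗ ϖ(t), and its left slices lie in C*(G). Therefore each a · w_i is in
the minimal tensor product, and so is the weak limit a. -/

theorem mem_of_mem_closure_span (f : E →L[ℂ] F) {D : Set E} {M : Submodule ℂ F}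
    (hM : IsClosed (M : Set F)) (h : ∀ x ∈ D, f x ∈ M) {x : E}
    (hx : x ∈ (Submodule.span ℂ D).topologicalClosure) : f x ∈ M := by
  have h1 : Submodule.span ℂ D ≤ M.comap f.toLinearMap := Submodule.span_le.2 h
  exact Submodule.topologicalClosure_minimal _ h1 (hM.preimage f.continuous) hx

theorem eq_of_mem_closure_span (f g : E →L[ℂ] F) {D : Set E} (h : ∀ x ∈ D, f x = g x) {x : E}
    (hx : x ∈ (Submodule.span ℂ D).topologicalClosure) : f x = g x := by
  have := mem_of_mem_closure_span (f - g) (M := ⊥) isClosed_singleton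
    (fun x hx => by simp [h x hx]) hx
  simpa [sub_eq_zero] using this

/-- A bounded linear relation into a Banach space extends to the closure of its domain. -/
theorem exists_mem_topologicalClosure_of_bound [CompleteSpace F] {ι : Type*} (f : ι → E) (g : ι → F)
    (C : ℝ) (h : ∀ p ∈ Submodule.span ℂ (Set.range fun i => (f i, g i)), ‖p.2‖ ≤ C * ‖p.1‖)
    {a : E} (ha : a ∈ (Submodule.span ℂ (Set.range f)).topologicalClosure) :
    ∃ b, (a, b) ∈ (Submodule.span ℂ (Set.range fun i => (f i, g i))).topologicalClosure := by
  set S := Submodule.span ℂ (Set.range fun i => (f i, g i)) with hS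
  have hmap : Submodule.span ℂ (Set.range f) ≤ S.map (LinearMap.fst ℂ E F) := by
    rw [Submodule.span_le]
    rintro _ ⟨i, rfl⟩
    exact ⟨(f i, g i), Submodule.subset_span ⟨i, rfl⟩, rfl⟩
  obtain ⟨x, hx, hxa⟩ := mem_closure_iff_seq_limit.1 (show a ∈ closure _ from ha)
  choose p hpS hp using fun n => hmap (hx n)
  have hp' : ∀ n, (p n).1 = x n := hp
  have hC : 0 ≤ |C| := abs_nonneg C
  -- The bound applies to differences of pairs, so well-definedness of a map need not be proved
  -- separately.
  have hcau : CauchySeq fun n => (p n).2 := by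
    have hxc := hxa.cauchySeq
    rw [Metric.cauchySeq_iff] at hxc ⊢
    intro ε hε
    -- `C` has no assumed sign, hence the absolute value; the added 1 keeps the denominator
    -- positive.
    obtain ⟨N, hN⟩ := hxc (ε / (|C| + 1)) (by positivity)
    refine ⟨N, fun m hm n hn => ?_⟩
    have h1 := h _ (S.sub_mem (hpS m) (hpS n))
    have h2 := hN m hm n hn
    rw [dist_eq_norm] at h2 ⊢
    rw [Prod.snd_sub, Prod.fst_sub, hp', hp'] at h1
    rw [lt_div_iff₀ (by positivity)] at h2
    have h3 : C * ‖x m - x n‖ ≤ |C| * ‖x m - x n‖ := by gcongr; exact le_abs_self C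
    nlinarith [norm_nonneg (x m - x n)]
  obtain ⟨b, hb⟩ := cauchySeq_tendsto_of_complete hcau
  refine ⟨b, mem_closure_iff_seq_limit.2 ⟨p, hpS, ?_⟩⟩
  refine (Prod.tendsto_iff _ _).2 ⟨?_, hb⟩
  simpa only [hp'] using hxa

end Closure

/-! ### Compressions of operators -/

section Sandwich

variable {E K : Type*} [NormedAddCommGroup E] [InnerProductSpace ℂ E] [CompleteSpace E]
  [NormedAddCommGroup K] [InnerProductSpace ℂ K] [CompleteSpace K]

/-- `W* T V` as a continuous linear function of `T`. -/
noncomputable def sandwich (V W : E →L[ℂ] K) : (K →L[ℂ] K) →L[ℂ] (E →L[ℂ] E) :=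
  (ContinuousLinearMap.compL ℂ E K E (ContinuousLinearMap.adjoint W)).comp
    ((ContinuousLinearMap.compL ℂ E K K).flip V)

theorem sandwich_apply (V W : E →L[ℂ] K) (T : K →L[ℂ] K) :
    sandwich V W T = (ContinuousLinearMap.adjoint W).comp (T.comp V) := rfl

theorem inner_sandwich (V W : E →L[ℂ] K) (T : K →L[ℂ] K) (a b : E) :
    ⟪a, sandwich V W T b⟫_ℂ = ⟪W a, T (V b)⟫_ℂ := by
  rw [sandwich_apply, ContinuousLinearMap.comp_apply, ContinuousLinearMap.adjoint_inner_right,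
    ContinuousLinearMap.comp_apply]

theorem norm_sandwich_le (V W : E →L[ℂ] K) (T : K →L[ℂ] K) :
    ‖sandwich V W T‖ ≤ ‖V‖ * ‖W‖ * ‖T‖ := by
  rw [sandwich_apply]
  calc _ ≤ ‖ContinuousLinearMap.adjoint W‖ * (‖T‖ * ‖V‖) :=
        (ContinuousLinearMap.opNorm_comp_le _ _).trans
          (by gcongr; exact ContinuousLinearMap.opNorm_comp_le _ _)
    _ = _ := by rw [LinearIsometryEquiv.norm_map]; ring

end Sandwich

/-! ### Tensor products of operators -/

section HilbertTensor

open UniformSpace (Completion)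

variable {E F : Type*} [NormedAddCommGroup E] [InnerProductSpace ℂ E] [NormedAddCommGroup F]
  [InnerProductSpace ℂ F]

/-- The elementary tensor in the Hilbert space tensor product of two spaces. -/
noncomputable def ctmul (x : E) (y : F) : Completion (E ⊗[ℂ] F) := ((x ⊗ₜ[ℂ] y : E ⊗[ℂ] F) :)

/-- `x ⊗ y` as a continuous linear function of `y`. -/
noncomputable def ctmulL (x : E) : F →L[ℂ] Completion (E ⊗[ℂ] F) :=
  (Completion.toComplL (𝕜 := ℂ) (E := E ⊗[ℂ] F)).comp (TensorProduct.mkL ℂ E F x)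

/-- `x ⊗ y` as a continuous linear function of `x`. -/
noncomputable def ctmulR (y : F) : E →L[ℂ] Completion (E ⊗[ℂ] F) :=
  (Completion.toComplL (𝕜 := ℂ) (E := E ⊗[ℂ] F)).comp ((TensorProduct.mkL ℂ E F).flip y)

/-- The tensor product of two operators on the Hilbert space tensor product. -/
noncomputable def cmap (x : E →L[ℂ] E) (y : F →L[ℂ] F) :
    Completion (E ⊗[ℂ] F) →L[ℂ] Completion (E ⊗[ℂ] F) :=
  (TensorProduct.mapL x y).completion

theorem ctmulR_apply (x : E) (y : F) : ctmulR y x = ctmul x y := rfl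

theorem cmap_ctmul (x : E →L[ℂ] E) (y : F →L[ℂ] F) (a : E) (b : F) :
    cmap x y (ctmul a b) = ctmul (x a) (y b) := by
  simp [cmap, ctmul]

theorem inner_ctmul (a c : E) (b d : F) : ⟪ctmul a b, ctmul c d⟫_ℂ = ⟪a, c⟫_ℂ * ⟪b, d⟫_ℂ := by
  simp [ctmul]

theorem norm_ctmul (a : E) (b : F) : ‖ctmul a b‖ = ‖a‖ * ‖b‖ := by
  simp [ctmul]

theorem norm_ctmulR_le (b : F) : ‖ctmulR (E := E) b‖ ≤ ‖b‖ :=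
  ContinuousLinearMap.opNorm_le_bound _ (norm_nonneg _) fun x => by
    rw [ctmulR_apply, norm_ctmul, mul_comm]

theorem eq_zero_of_inner_ctmul (v : Completion (E ⊗[ℂ] F))
    (h : ∀ a b, ⟪v, ctmul a b⟫_ℂ = 0) : v = 0 := by
  refine ext_inner_left ℂ fun z => ?_
  rw [inner_zero_right, inner_eq_zero_symm]
  induction z using Completion.induction_on with
  | hp => exact isClosed_eq (by fun_prop) (by fun_prop)
  | ih z =>
    induction z using TensorProduct.induction_on with
    | zero => rw [Completion.coe_zero, inner_zero_right]
    | tmul u v => exact h u v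
    | add u v hu hv => rw [Completion.coe_add, inner_add_right, hu, hv, add_zero]

theorem ext_ctmul {K : Type*} [NormedAddCommGroup K] [NormedSpace ℂ K]
    {S T : Completion (E ⊗[ℂ] F) →L[ℂ] K} (h : ∀ a b, S (ctmul a b) = T (ctmul a b)) : S = T := by
  ext z
  induction z using Completion.induction_on with
  | hp => exact isClosed_eq (by fun_prop) (by fun_prop)
  | ih z =>
    induction z using TensorProduct.induction_on with
    | zero => rw [Completion.coe_zero, map_zero, map_zero]
    | tmul u v => exact h u v
    | add u v hu hv => rw [Completion.coe_add, map_add, map_add, hu, hv]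

theorem cmap_mul (x x' : E →L[ℂ] E) (y y' : F →L[ℂ] F) :
    cmap x y * cmap x' y' = cmap (x * x') (y * y') :=
  ext_ctmul fun a b => by
    rw [mul_apply_eq_comp, cmap_ctmul, cmap_ctmul, cmap_ctmul]; rfl

theorem star_cmap [CompleteSpace E] [CompleteSpace F] (x : E →L[ℂ] E) (y : F →L[ℂ] F) :
    star (cmap x y) = cmap (star x) (star y) := by
  refine ext_ctmul fun a b => ?_
  rw [← sub_eq_zero]
  refine eq_zero_of_inner_ctmul _ fun c d => ?_
  rw [inner_sub_left, ContinuousLinearMap.star_eq_adjoint, ContinuousLinearMap.adjoint_inner_left,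
    cmap_ctmul, cmap_ctmul, inner_ctmul, inner_ctmul, ContinuousLinearMap.star_eq_adjoint,
    ContinuousLinearMap.star_eq_adjoint, ContinuousLinearMap.adjoint_inner_left,
    ContinuousLinearMap.adjoint_inner_left, sub_self]

/-- The slice `(1 ⊗ η)* T (1 ⊗ ξ)` of an operator, as a continuous linear function of `T`. -/
noncomputable def rightSlice [CompleteSpace E] (ξ η : F) :
    (Completion (E ⊗[ℂ] F) →L[ℂ] Completion (E ⊗[ℂ] F)) →L[ℂ] (E →L[ℂ] E) :=
  sandwich (ctmulR ξ) (ctmulR η)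

theorem inner_rightSlice [CompleteSpace E] (ξ η : F)
    (T : Completion (E ⊗[ℂ] F) →L[ℂ] Completion (E ⊗[ℂ] F)) (a b : E) :
    ⟪a, rightSlice ξ η T b⟫_ℂ = ⟪ctmul a η, T (ctmul b ξ)⟫_ℂ :=
  inner_sandwich _ _ _ _ _

theorem norm_rightSlice_le [CompleteSpace E] (ξ η : F)
    (T : Completion (E ⊗[ℂ] F) →L[ℂ] Completion (E ⊗[ℂ] F)) :
    ‖rightSlice ξ η T‖ ≤ ‖ξ‖ * ‖η‖ * ‖T‖ := by
  calc _ ≤ ‖ctmulR (E := E) ξ‖ * ‖ctmulR (E := E) η‖ * ‖T‖ := norm_sandwich_le _ _ _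
    _ ≤ _ := by gcongr <;> exact norm_ctmulR_le _

theorem rightSlice_cmap [CompleteSpace E] (ξ η : F) (x : E →L[ℂ] E) (y : F →L[ℂ] F) :
    rightSlice ξ η (cmap x y) = ⟪η, y ξ⟫_ℂ • x := by
  ext b
  refine ext_inner_left ℂ fun a => ?_
  rw [inner_rightSlice, cmap_ctmul, inner_ctmul, smul_apply, inner_smul_right,
    mul_comm]

/-- The slice `(η ⊗ 1)* T (ξ ⊗ 1)` of an operator, as a continuous linear function of `T`. -/
noncomputable def leftSlice [CompleteSpace F] (ξ η : E) :
    (Completion (E ⊗[ℂ] F) →L[ℂ] Completion (E ⊗[ℂ] F)) →L[ℂ] (F →L[ℂ] F) :=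
  sandwich (ctmulL ξ) (ctmulL η)

theorem inner_leftSlice [CompleteSpace F] (ξ η : E)
    (T : Completion (E ⊗[ℂ] F) →L[ℂ] Completion (E ⊗[ℂ] F)) (a b : F) :
    ⟪a, leftSlice ξ η T b⟫_ℂ = ⟪ctmul η a, T (ctmul ξ b)⟫_ℂ :=
  inner_sandwich _ _ _ _ _

theorem leftSlice_cmap [CompleteSpace F] (ξ η : E) (x : E →L[ℂ] E) (y : F →L[ℂ] F) :
    leftSlice ξ η (cmap x y) = ⟪η, x ξ⟫_ℂ • y := by
  ext b
  refine ext_inner_left ℂ fun a => ?_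
  rw [inner_leftSlice, cmap_ctmul, inner_ctmul, smul_apply, inner_smul_right]

/-- `x ⊗ y` as a continuous linear function of `x`. -/
theorem exists_cmap_flip (y : F →L[ℂ] F) :
    ∃ f : (E →L[ℂ] E) →L[ℂ] (Completion (E ⊗[ℂ] F) →L[ℂ] Completion (E ⊗[ℂ] F)),
      ∀ x, f x = cmap x y := by
  refine ⟨LinearMap.mkContinuous
    { toFun := fun x => cmap x y
      map_add' := fun x x' => ext_ctmul fun a b => ?_
      map_smul' := fun c x => ext_ctmul fun a b => ?_ } ‖y‖ fun x => ?_, fun x => rfl⟩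
  · rw [add_apply, cmap_ctmul, cmap_ctmul, cmap_ctmul]
    exact map_add (ctmulR (y b)) (x a) (x' a)
  · rw [RingHom.id_apply, smul_apply, cmap_ctmul, cmap_ctmul]
    exact map_smul (ctmulR (y b)) c (x a)
  · refine ContinuousLinearMap.opNorm_le_bound _ (by positivity) fun z => ?_
    change ‖cmap x y z‖ ≤ _
    induction z using Completion.induction_on with
    | hp => exact isClosed_le (by fun_prop) (by fun_prop)
    | ih z =>
      rw [cmap, ContinuousLinearMap.completion_apply_coe, Completion.norm_coe, Completion.norm_coe]
      refine (ContinuousLinearMap.le_opNorm _ _).trans ?_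
      gcongr
      rw [mul_comm]
      exact TensorProduct.norm_mapL_le x y

/-- `x ⊗ y` as a continuous linear function of `y`. -/
theorem exists_cmap (x : E →L[ℂ] E) :
    ∃ f : (F →L[ℂ] F) →L[ℂ] (Completion (E ⊗[ℂ] F) →L[ℂ] Completion (E ⊗[ℂ] F)),
      ∀ y, f y = cmap x y := by
  refine ⟨LinearMap.mkContinuous
    { toFun := fun y => cmap x y
      map_add' := fun y y' => ext_ctmul fun a b => ?_
      map_smul' := fun c y => ext_ctmul fun a b => ?_ } ‖x‖ fun y => ?_, fun x => rfl⟩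
  · rw [add_apply, cmap_ctmul, cmap_ctmul, cmap_ctmul]
    exact map_add (ctmulL (x a)) (y b) (y' b)
  · rw [RingHom.id_apply, smul_apply, cmap_ctmul, cmap_ctmul]
    exact map_smul (ctmulL (x a)) c (y b)
  · refine ContinuousLinearMap.opNorm_le_bound _ (by positivity) fun z => ?_
    change ‖cmap x y z‖ ≤ _
    induction z using Completion.induction_on with
    | hp => exact isClosed_le (by fun_prop) (by fun_prop)
    | ih z =>
      rw [cmap, ContinuousLinearMap.completion_apply_coe, Completion.norm_coe, Completion.norm_coe]
      refine (ContinuousLinearMap.le_opNorm _ _).trans ?_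
      gcongr
      exact TensorProduct.norm_mapL_le x y

end HilbertTensor

/-! ### Weak containment -/

section WeakContainment

/-- Taking 2^n-th roots makes the constant disappear in the limit; here it is phrased as
unboundedness of the powers of r / m > 1. -/
theorem le_of_pow_two_pow_le {r m C : ℝ} (hm : 0 ≤ m) (h : ∀ n : ℕ, r ^ 2 ^ n ≤ C * m ^ 2 ^ n) :
    r ≤ m := by
  by_contra! hlt
  rcases hm.eq_or_lt with rfl | hm
  · have := h 0
    simp at this
    linarith
  · have h1 : 1 < r / m := by rwa [one_lt_div hm]
    obtain ⟨n, hn⟩ := pow_unbounded_of_one_lt C h1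
    have h2 : (r / m) ^ n ≤ (r / m) ^ 2 ^ n := pow_le_pow_right₀ h1.le Nat.lt_two_pow_self.le
    have h3 := h n
    rw [← div_le_iff₀ (by positivity), ← div_pow] at h3
    linarith

variable {H₁ H₂ : Type*} [NormedAddCommGroup H₁] [InnerProductSpace ℂ H₁] [CompleteSpace H₁]
  [NormedAddCommGroup H₂] [InnerProductSpace ℂ H₂] [CompleteSpace H₂]

/-- Cauchy–Schwarz applied to ‖xz‖² = ⟨z, x*x z⟩. -/
theorem norm_apply_sq_le (x : H₂ →L[ℂ] H₂) (z : H₂) :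
    ‖x z‖ ^ 2 ≤ ‖z‖ * ‖(star x * x) z‖ := by
  have h : ((‖x z‖ ^ 2 : ℝ) : ℂ) = ⟪z, (star x * x) z⟫_ℂ := by
    rw [mul_apply_eq_comp, ContinuousLinearMap.star_eq_adjoint,
      ContinuousLinearMap.adjoint_inner_right, inner_self_eq_norm_sq_to_K]
    push_cast
    rfl
  have h2 : ‖((‖x z‖ ^ 2 : ℝ) : ℂ)‖ ≤ ‖z‖ * ‖(star x * x) z‖ := h ▸ norm_inner_le_norm _ _
  rwa [Complex.norm_real, Real.norm_of_nonneg (by positivity)] at h2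

/-- If vector states for a total set of vectors of a second representation are vector states of the
first one, then the second representation is dominated by the first. -/
theorem norm_le_of_vectorStates (S : Submodule ℂ ((H₁ →L[ℂ] H₁) × (H₂ →L[ℂ] H₂)))
    (hS : ∀ p ∈ S, star p * p ∈ S) (D : Set H₂)
    (hD : (Submodule.span ℂ D).topologicalClosure = ⊤)
    (h : ∀ z ∈ D, ∃ y : H₁, ∀ p ∈ S, ⟪z, p.2 z⟫_ℂ = ⟪y, p.1 y⟫_ℂ) :
    ∀ p ∈ S, ‖p.2‖ ≤ ‖p.1‖ := by
  -- The vector-state identity at p*p gives equality of norms for z in D. Linear combinations retain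
  -- only a crude constant depending on z, which the next step improves to ‖z‖.
  have hgood : ∀ z ∈ Submodule.span ℂ D, ∃ C : ℝ, ∀ p ∈ S, ‖p.2 z‖ ≤ C * ‖p.1‖ := by
    intro z hz
    induction hz using Submodule.span_induction with
    | mem z hz =>
      obtain ⟨y, hy⟩ := h z hz
      refine ⟨‖y‖, fun p hp => ?_⟩
      have h1 := hy _ (hS p hp)
      rw [Prod.snd_mul, Prod.fst_mul, Prod.snd_star, Prod.fst_star, mul_apply_eq_comp,
        mul_apply_eq_comp, ContinuousLinearMap.star_eq_adjoint,
        ContinuousLinearMap.star_eq_adjoint,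
        ContinuousLinearMap.adjoint_inner_right, ContinuousLinearMap.adjoint_inner_right,
        inner_self_eq_norm_sq_to_K, inner_self_eq_norm_sq_to_K] at h1
      have h2 : ‖p.2 z‖ ^ 2 = ‖p.1 y‖ ^ 2 := by exact_mod_cast h1
      rw [sq_eq_sq₀ (by positivity) (by positivity)] at h2
      rw [h2, mul_comm]
      exact p.1.le_opNorm y
    | zero => exact ⟨0, fun p _ => by simp⟩
    | add x y _ _ hx hy =>
      obtain ⟨C, hC⟩ := hx
      obtain ⟨C', hC'⟩ := hy
      refine ⟨C + C', fun p hp => ?_⟩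
      rw [map_add, add_mul]
      exact (norm_add_le _ _).trans (add_le_add (hC p hp) (hC' p hp))
    | smul c x _ hx =>
      obtain ⟨C, hC⟩ := hx
      refine ⟨‖c‖ * C, fun p hp => ?_⟩
      rw [map_smul, norm_smul, mul_assoc]
      gcongr
      exact hC p hp
  have hcontr : ∀ z ∈ Submodule.span ℂ D, ∀ p ∈ S, ‖p.2 z‖ ≤ ‖p.1‖ * ‖z‖ := by
    intro z hz p hp
    rcases eq_or_ne z 0 with rfl | hz0
    · simp
    have hzpos : 0 < ‖z‖ := norm_pos_iff.2 hz0
    obtain ⟨C, hC⟩ := hgood z hz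
    rw [← div_le_iff₀ hzpos]
    -- Replacing q by q*q squares ‖q.1‖ exactly, by the C*-identity, and at least squares ‖q.2 z‖ /
    -- ‖z‖. The constant stays the same under this iteration.
    have key : ∀ n : ℕ, ∀ q ∈ S, (‖q.2 z‖ / ‖z‖) ^ 2 ^ n ≤ C / ‖z‖ * ‖q.1‖ ^ 2 ^ n := by
      intro n
      induction n with
      | zero =>
        intro q hq
        have := hC q hq
        rw [pow_zero, pow_one, pow_one, div_mul_eq_mul_div]
        gcongr
      | succ n ih =>
        intro q hq
        have h1 := ih _ (hS q hq)
        have h2 : (‖q.2 z‖ / ‖z‖) ^ 2 ≤ ‖(star q * q).2 z‖ / ‖z‖ := by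
          rw [div_pow, div_le_div_iff₀ (by positivity) hzpos]
          have := norm_apply_sq_le q.2 z
          calc _ ≤ (‖z‖ * ‖(star q.2 * q.2) z‖) * ‖z‖ := by gcongr
            _ = _ := by
              change _ = ‖(star q.2 * q.2) z‖ * ‖z‖ ^ 2
              ring
        have h3 : ‖(star q * q).1‖ = ‖q.1‖ ^ 2 := by
          change ‖star q.1 * q.1‖ = _
          rw [CStarRing.norm_star_mul_self, sq]
        rw [h3, ← pow_mul, ← pow_succ'] at h1
        refine le_trans ?_ h1
        rw [pow_succ', pow_mul]
        gcongr
    exact le_of_pow_two_pow_le (norm_nonneg _) fun n => key n p hp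
  intro p hp
  refine ContinuousLinearMap.opNorm_le_bound _ (norm_nonneg _) fun z => ?_
  have hz : z ∈ closure (Submodule.span ℂ D : Set H₂) := by
    have : z ∈ (Submodule.span ℂ D).topologicalClosure := hD ▸ Submodule.mem_top
    exact this
  exact closure_minimal (t := {z | ‖p.2 z‖ ≤ ‖p.1‖ * ‖z‖}) (fun z hz => hcontr z hz p hp)
    (isClosed_le (by fun_prop) (by fun_prop)) hz

end WeakContainment

/-! ### Absorption of a representation in a tensor product -/

section Absorption

open UniformSpace (Completion)

theorem star_mul_self_mem_span {R Γ : Type*} [Ring R] [Algebra ℂ R] [StarRing R] [StarModule ℂ R]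
    [Group Γ] (f : Γ → R) (hmul : ∀ γ δ, f (γ * δ) = f γ * f δ) (hstar : ∀ γ, star (f γ) = f γ⁻¹)
    {x : R} (hx : x ∈ Submodule.span ℂ (Set.range f)) :
    star x * x ∈ Submodule.span ℂ (Set.range f) := by
  have h1 : star x ∈ Submodule.span ℂ (Set.range f) := by
    induction hx using Submodule.span_induction with
    | mem x hx =>
      obtain ⟨γ, rfl⟩ := hx
      exact Submodule.subset_span ⟨γ⁻¹, (hstar γ).symm⟩
    | zero => simp
    | add x y _ _ hx hy => rw [star_add]; exact add_mem hx hy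
    | smul c x _ hx => rw [star_smul]; exact Submodule.smul_mem _ _ hx
  have h2 := Submodule.mul_mem_mul h1 hx
  rw [Submodule.span_mul_span] at h2
  refine Submodule.span_mono ?_ h2
  rintro _ ⟨_, ⟨γ, rfl⟩, _, ⟨δ, rfl⟩, rfl⟩
  exact ⟨γ * δ, hmul γ δ⟩

/-- The matrix coefficient of an operator as a continuous linear functional. -/
noncomputable def coeffL {E : Type*} [NormedAddCommGroup E] [InnerProductSpace ℂ E] (ξ η : E) :
    (E →L[ℂ] E) →L[ℂ] ℂ :=
  (innerSL ℂ η).comp (ContinuousLinearMap.apply ℂ E ξ)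

theorem coeffL_apply {E : Type*} [NormedAddCommGroup E] [InnerProductSpace ℂ E] (ξ η : E)
    (T : E →L[ℂ] E) : coeffL ξ η T = ⟪η, T ξ⟫_ℂ := rfl

/-- A vector orthogonal to these tensors defines a functional that is continuous in each tensor
factor, so its vanishing extends to all elementary tensors one factor at a time. -/
theorem topologicalClosure_span_ctmul {K H : Type*} [NormedAddCommGroup K] [InnerProductSpace ℂ K]
    [NormedAddCommGroup H] [InnerProductSpace ℂ H] {D₁ : Set K} {D₂ : Set H}
    (h₁ : (Submodule.span ℂ D₁).topologicalClosure = ⊤)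
    (h₂ : (Submodule.span ℂ D₂).topologicalClosure = ⊤) :
    (Submodule.span ℂ {z | ∃ x ∈ D₁, ∃ y ∈ D₂, z = ctmul x y}).topologicalClosure = ⊤ := by
  rw [Submodule.topologicalClosure_eq_top_iff, eq_bot_iff]
  intro v hv
  have h : ∀ x ∈ D₁, ∀ y ∈ D₂, innerSL ℂ v (ctmul x y) = 0 :=
    fun x hx y hy => Submodule.inner_left_of_mem_orthogonal
      (Submodule.subset_span (s := {z | ∃ x ∈ D₁, ∃ y ∈ D₂, z = ctmul x y})
        ⟨x, hx, y, hy, rfl⟩) hv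
  refine eq_zero_of_inner_ctmul v fun x y => ?_
  refine eq_of_mem_closure_span ((innerSL ℂ v).comp (ctmulR y)) 0 (fun x hx => ?_)
    (h₁ ▸ Submodule.mem_top)
  exact eq_of_mem_closure_span ((innerSL ℂ v).comp (ctmulL x)) 0 (fun y hy => h x hx y hy)
    (h₂ ▸ Submodule.mem_top)

variable {K H Γ : Type*} [NormedAddCommGroup K] [InnerProductSpace ℂ K] [CompleteSpace K]
  [NormedAddCommGroup H] [InnerProductSpace ℂ H]

/-- Weak containment of A ⊗ U in A: the vector state of x ⊗ y is a product of coefficients, which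
`h` realises as a vector state of A, and such x ⊗ y are total. -/
theorem norm_snd_le_of_mem_span_cmap [CompleteSpace H] [Group Γ] {A : Γ → K →L[ℂ] K}
    {U : Γ → H →L[ℂ] H}
    (hA : ∀ γ δ, A (γ * δ) = A γ * A δ) (hA' : ∀ γ, star (A γ) = A γ⁻¹)
    (hU : ∀ γ δ, U (γ * δ) = U γ * U δ) (hU' : ∀ γ, star (U γ) = U γ⁻¹)
    {D₁ : Set K} {D₂ : Set H} (h₁ : (Submodule.span ℂ D₁).topologicalClosure = ⊤)
    (h₂ : (Submodule.span ℂ D₂).topologicalClosure = ⊤)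
    (h : ∀ x ∈ D₁, ∀ y ∈ D₂, ∃ v : K, ∀ γ,
      ⟪v, A γ v⟫_ℂ = ⟪x, A γ x⟫_ℂ * ⟪y, U γ y⟫_ℂ) :
    ∀ q ∈ Submodule.span ℂ (Set.range fun γ => (A γ, cmap (A γ) (U γ))), ‖q.2‖ ≤ ‖q.1‖ := by
  refine norm_le_of_vectorStates _ (fun q hq => star_mul_self_mem_span _ (fun γ δ => ?_)
    (fun γ => ?_) hq) _ (topologicalClosure_span_ctmul h₁ h₂) ?_
  · rw [Prod.mk_mul_mk, cmap_mul, hA, hU]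
  · rw [← hA', ← hU', ← star_cmap]; rfl
  rintro _ ⟨x, hx, y, hy, rfl⟩
  obtain ⟨v, hv⟩ := h x hx y hy
  refine ⟨v, fun q hq => ?_⟩
  induction hq using Submodule.span_induction with
  | mem q hq =>
    obtain ⟨γ, rfl⟩ := hq
    rw [hv, cmap_ctmul, inner_ctmul]
  | zero => simp
  | add a b _ _ ha hb =>
    rw [Prod.snd_add, Prod.fst_add, add_apply, add_apply, inner_add_right, inner_add_right, ha, hb]
  | smul c a _ ha =>
    rw [Prod.smul_snd, Prod.smul_fst, smul_apply, smul_apply, inner_smul_right, inner_smul_right,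
      ha]

variable {A : Γ → K →L[ℂ] K} {U : Γ → H →L[ℂ] H} {a : K →L[ℂ] K}

/-! ### Slices of an extended coproduct -/

section Slices

variable {K₂ : Type*} [NormedAddCommGroup K₂] [NormedSpace ℂ K₂]
  {Θ : Γ → K₂} {θ : K₂} {slice : H → H → K₂ →L[ℂ] (K →L[ℂ] K)}

/-- Only the rule `hs` for slicing Θ γ matters: it sends generators to multiples of A γ, and slicing
is bounded. -/
theorem slice_mem_closure_span
    (hs : ∀ ξ η γ, slice ξ η (Θ γ) = ⟪η, U γ ξ⟫_ℂ • A γ) (h : (a, θ) ∈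
      (Submodule.span ℂ (Set.range fun γ => (A γ, Θ γ))).topologicalClosure)
    (ξ η : H) : slice ξ η θ ∈ (Submodule.span ℂ (Set.range A)).topologicalClosure := by
  refine mem_of_mem_closure_span ((slice ξ η).comp (ContinuousLinearMap.snd ℂ _ _))
    (Submodule.isClosed_topologicalClosure _) ?_ h
  rintro _ ⟨γ, rfl⟩
  change slice ξ η (Θ γ) ∈ _
  rw [hs]
  exact Submodule.smul_mem _ _ (Submodule.le_topologicalClosure _ (Submodule.subset_span ⟨γ, rfl⟩))

/-- Both sides are continuous and linear in the pair (a, θ), and at generators the identity is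
`hxy`. It later becomes the defining formula of the module actions. -/
theorem inner_slice_eq (hs : ∀ ξ η γ, slice ξ η (Θ γ) = ⟪η, U γ ξ⟫_ℂ • A γ) (h : (a, θ) ∈
      (Submodule.span ℂ (Set.range fun γ => (A γ, Θ γ))).topologicalClosure)
    (ξ η : H) (x y x' y' : K)
    (hxy : ∀ γ, ⟪y', A γ x'⟫_ℂ = ⟪y, A γ x⟫_ℂ * ⟪η, U γ ξ⟫_ℂ) :
    ⟪y, slice ξ η θ x⟫_ℂ = ⟪y', a x'⟫_ℂ := by
  refine eq_of_mem_closure_span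
    ((coeffL x y).comp ((slice ξ η).comp (ContinuousLinearMap.snd ℂ _ _)))
    ((coeffL x' y').comp (ContinuousLinearMap.fst ℂ _ _)) ?_ h
  rintro _ ⟨γ, rfl⟩
  change coeffL x y (slice ξ η (Θ γ)) = coeffL x' y' (A γ)
  rw [hs, map_smul, coeffL_apply, coeffL_apply, hxy, smul_eq_mul, mul_comm]

/-- Functionals of the slices are matrix coefficients of an operator in the closed span of `U`. -/
theorem exists_operator_of_slices [CompleteSpace H]
    (hs : ∀ ξ η γ, slice ξ η (Θ γ) = ⟪η, U γ ξ⟫_ℂ • A γ)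
    (hb : ∀ ξ η T, ‖slice ξ η T‖ ≤ ‖ξ‖ * ‖η‖ * ‖T‖) (h : (a, θ) ∈
      (Submodule.span ℂ (Set.range fun γ => (A γ, Θ γ))).topologicalClosure)
    (F : StrongDual ℂ (K →L[ℂ] K)) :
    ∃ x ∈ (Submodule.span ℂ (Set.range U)).topologicalClosure,
      ∀ ξ η : H, F (slice ξ η θ) = ⟪η, x ξ⟫_ℂ := by
  have hθ : θ ∈ (Submodule.span ℂ (Set.range Θ)).topologicalClosure := by
    refine mem_of_mem_closure_span (ContinuousLinearMap.snd ℂ _ _)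
      (Submodule.isClosed_topologicalClosure _) ?_ h
    rintro _ ⟨γ, rfl⟩
    exact Submodule.le_topologicalClosure _ (Submodule.subset_span ⟨γ, rfl⟩)
  -- In such a pair the second entry plays the role of (F ⊗ id) applied to the first.
  have hslice : ∀ (ξ η : H) (q : K₂ × (H →L[ℂ] H)), q ∈ (Submodule.span ℂ
        (Set.range fun γ => (Θ γ, F (A γ) • U γ))).topologicalClosure →
      F (slice ξ η q.1) = ⟪η, q.2 ξ⟫_ℂ := by
    intro ξ η q hq
    refine eq_of_mem_closure_span
      (F.comp ((slice ξ η).comp (ContinuousLinearMap.fst ℂ _ _)))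
      ((coeffL ξ η).comp (ContinuousLinearMap.snd ℂ _ _)) ?_ hq
    rintro _ ⟨γ, rfl⟩
    change F (slice ξ η (Θ γ)) = coeffL ξ η (F (A γ) • U γ)
    rw [hs, map_smul, map_smul, coeffL_apply, smul_eq_mul, smul_eq_mul, mul_comm]
  -- The operator norm is tested on matrix coefficients at unit vectors; these are values of F on
  -- slices of norm at most ‖q.1‖.
  have hbound : ∀ q ∈ Submodule.span ℂ (Set.range fun γ => (Θ γ, F (A γ) • U γ)),
      ‖q.2‖ ≤ ‖F‖ * ‖q.1‖ := by
    intro q hq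
    refine ContinuousLinearMap.opNorm_le_of_re_inner_le (by positivity) fun ξ η hξ hη => ?_
    rw [← inner_conj_symm, RCLike.conj_re]
    refine (RCLike.re_le_norm _).trans ?_
    rw [← hslice ξ η q (Submodule.le_topologicalClosure _ hq)]
    refine (F.le_opNorm _).trans ?_
    gcongr
    refine (hb ξ η q.1).trans (mul_le_of_le_one_left (norm_nonneg _) ?_)
    simp [hξ, hη]
  obtain ⟨x, hx⟩ := exists_mem_topologicalClosure_of_bound Θ
    (fun γ => F (A γ) • U γ) ‖F‖ hbound hθ
  refine ⟨x, ?_, fun ξ η => hslice ξ η _ hx⟩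
  refine mem_of_mem_closure_span (ContinuousLinearMap.snd ℂ _ _)
    (Submodule.isClosed_topologicalClosure _) ?_ hx
  rintro _ ⟨γ, rfl⟩
  exact Submodule.smul_mem _ _
    (Submodule.le_topologicalClosure _ (Submodule.subset_span ⟨γ, rfl⟩))

end Slices

/-- The three conclusions serve the orbit maps in turn: their values stay in the algebra, they
satisfy the action formula, and functionals of them are evaluations at elements of the predual
algebra. -/
theorem exists_slices_of_bound {K' : Type*} [NormedAddCommGroup K'] [InnerProductSpace ℂ K']
    [CompleteSpace K'] [CompleteSpace H] {Θ : Γ → K' →L[ℂ] K'}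
    {slice : H → H → (K' →L[ℂ] K') →L[ℂ] (K →L[ℂ] K)}
    (hs : ∀ ξ η γ, slice ξ η (Θ γ) = ⟪η, U γ ξ⟫_ℂ • A γ)
    (hb : ∀ ξ η T, ‖slice ξ η T‖ ≤ ‖ξ‖ * ‖η‖ * ‖T‖)
    (hΘ : ∀ q ∈ Submodule.span ℂ (Set.range fun γ => (A γ, Θ γ)), ‖q.2‖ ≤ ‖q.1‖)
    (ha : a ∈ (Submodule.span ℂ (Set.range A)).topologicalClosure) :
    ∃ L : H → H → K →L[ℂ] K,
      (∀ ξ η, L ξ η ∈ (Submodule.span ℂ (Set.range A)).topologicalClosure) ∧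
      (∀ ξ η x y x' y', (∀ γ, ⟪y', A γ x'⟫_ℂ = ⟪y, A γ x⟫_ℂ * ⟪η, U γ ξ⟫_ℂ) →
        ⟪y, L ξ η x⟫_ℂ = ⟪y', a x'⟫_ℂ) ∧
      ∀ F : StrongDual ℂ (K →L[ℂ] K), ∃ x ∈ (Submodule.span ℂ (Set.range U)).topologicalClosure,
        ∀ ξ η : H, F (L ξ η) = ⟪η, x ξ⟫_ℂ := by
  obtain ⟨θ, hθ⟩ := exists_mem_topologicalClosure_of_bound A Θ 1
    (fun q hq => (one_mul ‖q.1‖).symm ▸ hΘ q hq) ha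
  exact ⟨fun ξ η => slice ξ η θ, slice_mem_closure_span hs hθ, inner_slice_eq hs hθ,
    exists_operator_of_slices hs hb hθ⟩

/-- Slicing the extension of `A γ ↦ A γ ⊗ U γ` to the closed span of `A`. -/
theorem exists_slices [CompleteSpace H] [Group Γ]
    (hA : ∀ γ δ, A (γ * δ) = A γ * A δ) (hA' : ∀ γ, star (A γ) = A γ⁻¹)
    (hU : ∀ γ δ, U (γ * δ) = U γ * U δ) (hU' : ∀ γ, star (U γ) = U γ⁻¹)
    {D₁ : Set K} {D₂ : Set H} (h₁ : (Submodule.span ℂ D₁).topologicalClosure = ⊤)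
    (h₂ : (Submodule.span ℂ D₂).topologicalClosure = ⊤)
    (h : ∀ x ∈ D₁, ∀ y ∈ D₂, ∃ v : K, ∀ γ,
      ⟪v, A γ v⟫_ℂ = ⟪x, A γ x⟫_ℂ * ⟪y, U γ y⟫_ℂ)
    (ha : a ∈ (Submodule.span ℂ (Set.range A)).topologicalClosure) :
    ∃ L : H → H → K →L[ℂ] K,
      (∀ ξ η, L ξ η ∈ (Submodule.span ℂ (Set.range A)).topologicalClosure) ∧
      (∀ ξ η x y x' y', (∀ γ, ⟪y', A γ x'⟫_ℂ = ⟪y, A γ x⟫_ℂ * ⟪η, U γ ξ⟫_ℂ) →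
        ⟪y, L ξ η x⟫_ℂ = ⟪y', a x'⟫_ℂ) ∧
      ∀ F : StrongDual ℂ (K →L[ℂ] K), ∃ x ∈ (Submodule.span ℂ (Set.range U)).topologicalClosure,
        ∀ ξ η : H, F (L ξ η) = ⟪η, x ξ⟫_ℂ := by
  have hΘ := norm_snd_le_of_mem_span_cmap hA hA' hU hU' h₁ h₂ h
  exact exists_slices_of_bound (fun ξ η γ => rightSlice_cmap _ _ _ _) norm_rightSlice_le
    (norm_snd_le_of_mem_span_cmap hA hA' hU hU' h₁ h₂ h) ha

end Absorption

/-! ### The minimal tensor product -/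

/-- Density is used in one variable at a time, so separate continuity is enough. -/
theorem mem_closure_span_of_bilinear {X Y K Γ Δ : Type*} [NormedAddCommGroup X] [NormedSpace ℂ X]
    [NormedAddCommGroup Y] [NormedSpace ℂ Y] [NormedAddCommGroup K] [NormedSpace ℂ K]
    {φ : X → Y → K →L[ℂ] K} (h₁ : ∀ y, ∃ f : X →L[ℂ] (K →L[ℂ] K), ∀ x, f x = φ x y)
    (h₂ : ∀ x, ∃ f : Y →L[ℂ] (K →L[ℂ] K), ∀ y, f y = φ x y) {A : Γ → X} {B : Δ → Y} {x : X} {y : Y}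
    (hx : x ∈ (Submodule.span ℂ (Set.range A)).topologicalClosure)
    (hy : y ∈ (Submodule.span ℂ (Set.range B)).topologicalClosure) :
    φ x y ∈ (Submodule.span ℂ
      (Set.range fun γ : Γ × Δ => φ (A γ.1) (B γ.2))).topologicalClosure := by
  obtain ⟨f, hf⟩ := h₁ y
  rw [← hf]
  refine mem_of_mem_closure_span f (Submodule.isClosed_topologicalClosure _) ?_ hx
  rintro _ ⟨s, rfl⟩
  obtain ⟨g, hg⟩ := h₂ (A s)
  rw [hf, ← hg]
  refine mem_of_mem_closure_span g (Submodule.isClosed_topologicalClosure _) ?_ hy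
  rintro _ ⟨t, rfl⟩
  rw [hg]
  exact Submodule.le_topologicalClosure _ (Submodule.subset_span ⟨(s, t), rfl⟩)

section MinTensor

variable {G : Type u} [Group G]

theorem univOp_mul (s t : G) : univOp (s * t) = univOp s * univOp t := by
  ext f : 1
  change univRep G (s * t) f = univRep G s (univRep G t f)
  rw [map_mul]
  rfl

theorem star_univOp (s : G) : star (univOp s) = univOp s⁻¹ := by
  rw [ContinuousLinearMap.star_eq_adjoint]
  symm
  rw [ContinuousLinearMap.eq_adjoint_iff]
  intro x y
  rw [univOp_apply, univOp_apply, ← (univRep G s).inner_map_map, map_inv]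
  congr 1
  exact (univRep G s).apply_symm_apply x

/-- The operator `ϖ(s) ⊗ ϖ(t)`. -/
noncomputable def pairOp (γ : G × G) :
    HilbertTensorSq (UnivSpace G) →L[ℂ] HilbertTensorSq (UnivSpace G) :=
  cmap (univOp γ.1) (univOp γ.2)

theorem pairOp_mul (γ δ : G × G) : pairOp (γ * δ) = pairOp γ * pairOp δ := by
  rw [pairOp, pairOp, pairOp, cmap_mul, Prod.fst_mul, Prod.snd_mul, univOp_mul, univOp_mul]

theorem star_pairOp (γ : G × G) : star (pairOp γ) = pairOp γ⁻¹ := by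
  rw [pairOp, pairOp, star_cmap, star_univOp, star_univOp, Prod.fst_inv, Prod.snd_inv]

theorem inner_pairOp (γ : G × G) (a b c d : UnivSpace G) :
    ⟪ctmul a b, pairOp γ (ctmul c d)⟫_ℂ = ⟪a, univOp γ.1 c⟫_ℂ * ⟪b, univOp γ.2 d⟫_ℂ := by
  rw [pairOp, cmap_ctmul, inner_ctmul]

theorem minTensor_eq :
    minTensor G = (Submodule.span ℂ (Set.range (pairOp (G := G)))).topologicalClosure := by
  apply le_antisymm
  · refine Submodule.topologicalClosure_minimal _ (Submodule.span_le.2 ?_)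
      (Submodule.isClosed_topologicalClosure _)
    rintro _ ⟨x, hx, y, hy, rfl⟩
    exact mem_closure_span_of_bilinear exists_cmap_flip exists_cmap hx hy
  · refine Submodule.topologicalClosure_mono (Submodule.span_mono ?_)
    rintro _ ⟨γ, rfl⟩
    exact ⟨_, univOp_mem_fullCStar γ.1, _, univOp_mem_fullCStar γ.2, rfl⟩

/-- Vectors in single summands of the universal representation are total. -/
theorem topologicalClosure_span_single [DecidableEq (CyclicRep G)] :
    (Submodule.span ℂ {z : UnivSpace G | ∃ (σ : CyclicRep G) (x : σ.space),
      z = lp.single 2 σ x}).topologicalClosure = ⊤ := by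
  rw [Submodule.topologicalClosure_eq_top_iff, eq_bot_iff]
  intro v hv
  have h : innerSL ℂ v = 0 :=
    lp.ext_continuousLinearMap (by norm_num) fun σ => by
      ext x
      exact Submodule.inner_left_of_mem_orthogonal
        (Submodule.subset_span (s := {z : UnivSpace G | ∃ (σ : CyclicRep G) (x : σ.space),
          z = lp.single 2 σ x}) ⟨σ, x, rfl⟩) hv
  exact (innerSL_apply_norm (𝕜 := ℂ) v ▸ by simp [h] : ‖v‖ = 0) |> norm_eq_zero.1

theorem inner_single_univOp [DecidableEq (CyclicRep G)] (σ : CyclicRep G) (x : σ.space) (s : G) :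
    ⟪(lp.single 2 σ x : UnivSpace G), univOp s (lp.single 2 σ x : UnivSpace G)⟫_ℂ =
      ⟪x, σ.rep s x⟫_ℂ := by
  rw [lp.inner_single_left, univOp_apply, univRep_apply, lp.single_apply_self]

/-- The product of two vector states in single summands is a vector state. -/
theorem exists_vector_mul [DecidableEq (CyclicRep G)] (σ κ : CyclicRep G) (x : σ.space)
    (k : κ.space) : ∃ v : UnivSpace G, ∀ s,
      ⟪v, univOp s v⟫_ℂ = ⟪(lp.single 2 σ x : UnivSpace G), univOp s (lp.single 2 σ x)⟫_ℂ *
        ⟪(lp.single 2 κ k : UnivSpace G), univOp s (lp.single 2 κ k)⟫_ℂ := by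
  -- The cyclic subrepresentation generated by x ⊗ k in σ ⊗ κ is itself a summand of ϖ.
  obtain ⟨ρ, V, ξ, hξ, hV⟩ := exists_cyclicRep (tensorRep σ.rep κ.rep) (ctmul x k)
  refine ⟨lp.single 2 ρ ξ, fun s => ?_⟩
  rw [inner_single_univOp, inner_single_univOp, inner_single_univOp, ← V.inner_map_map, hV, hξ]
  change ⟪_, tensorRepIsometry _ _ _ _⟫_ℂ = _
  rw [ctmul, tensorRepIsometry_coe, UniformSpace.Completion.inner_coe]
  simp

/-- The slices of the coproduct of an element of the minimal tensor product. -/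
theorem exists_slices_of_mem_minTensor {p : G × G →* G}
    (hp : p = MonoidHom.fst G G ∨ p = MonoidHom.snd G G)
    {a : HilbertTensorSq (UnivSpace G) →L[ℂ] HilbertTensorSq (UnivSpace G)}
    (ha : a ∈ minTensor G) :
    ∃ L : UnivSpace G → UnivSpace G →
        HilbertTensorSq (UnivSpace G) →L[ℂ] HilbertTensorSq (UnivSpace G),
      (∀ ξ η, L ξ η ∈ minTensor G) ∧
      (∀ ξ η x y x' y', (∀ γ, ⟪y', pairOp γ x'⟫_ℂ = ⟪y, pairOp γ x⟫_ℂ * ⟪η, univOp (p γ) ξ⟫_ℂ) →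
        ⟪y, L ξ η x⟫_ℂ = ⟪y', a x'⟫_ℂ) ∧
      ∀ F : StrongDual ℂ (HilbertTensorSq (UnivSpace G) →L[ℂ] HilbertTensorSq (UnivSpace G)),
        ∃ x ∈ fullCStar G, ∀ ξ η, F (L ξ η) = ⟪η, x ξ⟫_ℂ := by
  classical
  rw [minTensor_eq] at ha ⊢
  -- The extra factor involves only the coordinate chosen by `p`, so it can be absorbed into the
  -- vector of that leg while the other leg is unchanged.
  have h : ∀ z ∈ {z : HilbertTensorSq (UnivSpace G) |
        ∃ x ∈ {z : UnivSpace G | ∃ (σ : CyclicRep G) (x : σ.space), z = lp.single 2 σ x},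
        ∃ y ∈ {z : UnivSpace G | ∃ (σ : CyclicRep G) (x : σ.space), z = lp.single 2 σ x},
          z = ctmul x y},
      ∀ k ∈ {z : UnivSpace G | ∃ (σ : CyclicRep G) (x : σ.space), z = lp.single 2 σ x},
      ∃ v : HilbertTensorSq (UnivSpace G), ∀ γ,
        ⟪v, pairOp γ v⟫_ℂ = ⟪z, pairOp γ z⟫_ℂ * ⟪k, univOp (p γ) k⟫_ℂ := by
    rintro _ ⟨_, ⟨σ, x, rfl⟩, _, ⟨τ, y, rfl⟩, rfl⟩ _ ⟨κ, k, rfl⟩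
    rcases hp with rfl | rfl
    · obtain ⟨v, hv⟩ := exists_vector_mul σ κ x k
      refine ⟨ctmul v (lp.single 2 τ y), fun γ => ?_⟩
      rw [inner_pairOp, inner_pairOp, hv, MonoidHom.coe_fst]
      ring
    · obtain ⟨v, hv⟩ := exists_vector_mul τ κ y k
      refine ⟨ctmul (lp.single 2 σ x) v, fun γ => ?_⟩
      rw [inner_pairOp, inner_pairOp, hv, MonoidHom.coe_snd]
      ring
  obtain ⟨L, h1, h2, h3⟩ := exists_slices (U := fun γ => univOp (p γ)) pairOp_mul star_pairOp
    (fun γ δ => by rw [map_mul, univOp_mul]) (fun γ => by rw [map_inv, star_univOp])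
    (topologicalClosure_span_ctmul topologicalClosure_span_single topologicalClosure_span_single)
    topologicalClosure_span_single h ha
  refine ⟨L, h1, h2, fun F => ?_⟩
  obtain ⟨x, hx, hF⟩ := h3 F
  refine ⟨x, Submodule.topologicalClosure_mono (Submodule.span_mono ?_) hx, hF⟩
  rintro _ ⟨γ, rfl⟩
  exact ⟨p γ, rfl⟩

end MinTensor

/-! ### Generated von Neumann algebras -/

section VonNeumann

variable {H : Type*} [NormedAddCommGroup H] [InnerProductSpace ℂ H] [CompleteSpace H]

theorem mem_vonNeumannGenerated_iff {S : Set (H →L[ℂ] H)} {z : H →L[ℂ] H} :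
    z ∈ vonNeumannGenerated S ↔
      ∀ g : H →L[ℂ] H, (∀ x ∈ S, x * g = g * x) → (∀ x ∈ S, star x * g = g * star x) →
        g * z = z * g := by
  rw [vonNeumannGenerated, VonNeumannAlgebra.mem_commutant_iff]
  refine forall_congr' fun g => ?_
  rw [← and_imp]
  refine imp_congr_left ?_
  change g ∈ StarSubalgebra.centralizer ℂ S ↔ _
  rw [StarSubalgebra.mem_centralizer_iff]
  exact ⟨fun h => ⟨fun x hx => (h x hx).1, fun x hx => (h x hx).2⟩,
    fun h x hx => ⟨h.1 x hx, h.2 x hx⟩⟩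

theorem subset_vonNeumannGenerated {S : Set (H →L[ℂ] H)} {z : H →L[ℂ] H} (hz : z ∈ S) :
    z ∈ vonNeumannGenerated S :=
  mem_vonNeumannGenerated_iff.2 fun _ h _ => (h z hz).symm

theorem isClosed_vonNeumannAlgebra (M : VonNeumannAlgebra H) :
    IsClosed (M.toSubspace : Set (H →L[ℂ] H)) := by
  have h : (M.toSubspace : Set (H →L[ℂ] H)) = ⋂ g ∈ M.commutant, {z | g * z = z * g} := by
    ext z
    simp only [Set.mem_iInter, Set.mem_ofPred_eq]
    change z ∈ M ↔ _
    conv_lhs => rw [← M.commutant_commutant]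
    rw [VonNeumannAlgebra.mem_commutant_iff]
  rw [h]
  exact isClosed_biInter fun g _ => isClosed_eq (by fun_prop) (by fun_prop)

end VonNeumann

/-! ### The minimal tensor product has weakly continuous orbit maps -/

section MinTensorSubset

variable {G : Type u} [Group G]

theorem univOp_mem_groupWStar (s : G) : univOp s ∈ groupWStar G :=
  subset_vonNeumannGenerated ⟨s, rfl⟩

theorem minTensor_le_wStarTensor : minTensor G ≤ (wStarTensor G).toSubspace := by
  rw [minTensor_eq]
  refine Submodule.topologicalClosure_minimal _ (Submodule.span_le.2 ?_)
    (isClosed_vonNeumannAlgebra _)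
  rintro _ ⟨γ, rfl⟩
  exact subset_vonNeumannGenerated
    ⟨_, univOp_mem_groupWStar γ.1, _, univOp_mem_groupWStar γ.2, rfl⟩

/-- Uniqueness of the extension to C*(G) allows any pair of representing vectors to compute the
duality. -/
theorem FourierStieltjes.toDual_eq_inner {w : FourierStieltjes G} {ξ η : UnivSpace G}
    (h : ∀ s, w s = ⟪η, univOp s ξ⟫_ℂ) (x : fullCStar G) : w.toDual x = ⟪η, x.1 ξ⟫_ℂ := by
  have := w.existsUnique_dual.unique (y₁ := w.toDual)
    (y₂ := (coeffL ξ η).comp (fullCStar G).subtypeL) w.toDual_apply (fun s => (h s).symm)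
  rw [this]
  rfl

theorem FourierStieltjes.continuous_toDual (x : fullCStar G) :
    Continuous fun w : FourierStieltjes G => w.toDual x :=
  (continuous_apply x).comp continuous_induced_dom

/-- A family of elements of the minimal tensor product whose images under functionals are given
by `C*(G)` is continuous for the weak topologies. -/
theorem continuous_toWeakSpace
    (L : FourierStieltjes G → (wStarTensor G).toSubspace) (ξ η : FourierStieltjes G → UnivSpace G)
    (hw : ∀ w s, w s = ⟪η w, univOp s (ξ w)⟫_ℂ)
    (h : ∀ F : StrongDual ℂ (HilbertTensorSq (UnivSpace G) →L[ℂ] HilbertTensorSq (UnivSpace G)),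
        ∃ x ∈ fullCStar G, ∀ w, F (L w).1 = ⟪η w, x (ξ w)⟫_ℂ) :
    Continuous (fun w => toWeakSpace ℂ (wStarTensor G).toSubspace (L w)) := by
  refine WeakBilin.continuous_of_continuous_eval _ fun F => ?_
  change Continuous fun w => F (L w)
  -- Hahn–Banach moves the functional to all bounded operators, where the slice formula is
  -- available.
  obtain ⟨F', hF', -⟩ := exists_extension_norm_eq (wStarTensor G).toSubspace F
  obtain ⟨x, hx, hF⟩ := h F'
  convert FourierStieltjes.continuous_toDual ⟨x, hx⟩ using 2 with w
  rw [← hF', hF, FourierStieltjes.toDual_eq_inner (hw w)]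

theorem mem_cSigmaW_of_mem_minTensor
    {a : HilbertTensorSq (UnivSpace G) →L[ℂ] HilbertTensorSq (UnivSpace G)}
    (ha : a ∈ minTensor G) :
    (⟨a, minTensor_le_wStarTensor ha⟩ : (wStarTensor G).toSubspace) ∈ cSigmaW G := by
  choose ξ η hw using FourierStieltjes.exists_univ (G := G)
  -- The left action multiplies the second leg, hence the second projection; the right action uses
  -- the first.
  obtain ⟨L, hL1, hL2, hL3⟩ := exists_slices_of_mem_minTensor (Or.inr rfl) ha
  obtain ⟨R, hR1, hR2, hR3⟩ := exists_slices_of_mem_minTensor (Or.inl rfl) ha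
  refine ⟨fun w => ⟨L (ξ w) (η w), minTensor_le_wStarTensor (hL1 _ _)⟩,
    fun w => ⟨R (ξ w) (η w), minTensor_le_wStarTensor (hR1 _ _)⟩, fun w => ?_, fun w => ?_, ?_, ?_⟩
  · intro ξ₁ η₁ ξ₂ η₂ ξ₂' η₂' h
    refine hL2 _ _ _ _ _ _ fun γ => ?_
    refine (inner_pairOp _ _ _ _ _).trans ?_
    rw [h, hw]
    refine Eq.trans ?_ (congrArg (· * _) (inner_pairOp _ _ _ _ _).symm)
    exact (mul_assoc _ _ _).symm
  · intro ξ₁ η₁ ξ₂ η₂ ξ₁' η₁' h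
    refine hR2 _ _ _ _ _ _ fun γ => ?_
    refine (inner_pairOp _ _ _ _ _).trans ?_
    rw [h, hw]
    refine Eq.trans ?_ (congrArg (· * _) (inner_pairOp _ _ _ _ _).symm)
    rw [MonoidHom.coe_fst]
    ring
  · refine continuous_toWeakSpace _ ξ η hw fun F => ?_
    obtain ⟨x, hx, hF⟩ := hL3 F
    exact ⟨x, hx, fun w => hF _ _⟩
  · refine continuous_toWeakSpace _ ξ η hw fun F => ?_
    obtain ⟨x, hx, hF⟩ := hR3 F
    exact ⟨x, hx, fun w => hF _ _⟩

end MinTensorSubset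

/-! ### Amenability -/

section Amenability

open Filter Topology

variable {G : Type u} [Group G]

/-- A bounded real function as an element of `ℓ^∞(G)`. -/
def boundedFun (f : G → ℝ) (C : ℝ) (h : ∀ g, |f g| ≤ C) : lp (fun _ : G => ℝ) ∞ :=
  ⟨f, memℓp_infty ⟨C, by rintro _ ⟨g, rfl⟩; exact h g⟩⟩

/-- Functions of the form `∑ s ∈ E, (f s (s g) - f s g)` are not bounded below by a positive
constant. -/
theorem IsAmenableGroup.not_forall_lt_sum (hG : IsAmenableGroup G) (E : Finset G) (f : G → G → ℝ)
    (C : ℝ) (hC : ∀ s g, |f s g| ≤ C) {c : ℝ} (hc : 0 < c) :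
    ¬ ∀ g, c < ∑ s ∈ E, (f s (s * g) - f s g) := by
  obtain ⟨m, hpos, hone, hinv⟩ := hG
  intro h
  set F : G → lp (fun _ : G => ℝ) ∞ := fun s => boundedFun (f s) C (hC s)
  set F' : G → lp (fun _ : G => ℝ) ∞ := fun s => boundedFun (fun g => f s (s * g)) C
    fun g => hC s _
  set I : lp (fun _ : G => ℝ) ∞ := boundedFun (fun _ => 1) 1 (by simp)
  have hm : ∀ s, m (F' s) = m (F s) := fun s => hinv s⁻¹ (F s) (F' s) fun x => by
    change f s (s * x) = f s (s⁻¹⁻¹ * x)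
    rw [inv_inv]
  -- This function is nonnegative by assumption, yet invariance gives it mean −c < 0.
  have h1 := hpos (∑ s ∈ E, (F' s - F s) - c • I) fun x => by
    have hx : (∑ s ∈ E, (F' s - F s) - c • I) x = ∑ s ∈ E, (f s (s * x) - f s x) - c := by
      rw [lp.coeFn_sub, Pi.sub_apply, lp.coeFn_sum, Finset.sum_apply, lp.coeFn_smul, Pi.smul_apply]
      change _ - c • (1 : ℝ) = _
      rw [smul_eq_mul, mul_one]
      rfl
    rw [hx]
    linarith [h x]
  rw [map_sub, map_sum, map_smul, hone I fun _ => rfl] at h1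
  have h2 : ∑ s ∈ E, m (F' s - F s) = 0 :=
    Finset.sum_eq_zero fun s _ => by rw [map_sub, hm, sub_self]
  rw [h2, smul_eq_mul] at h1
  linarith

/-- Reiter's condition for finitely supported functions. -/
theorem IsAmenableGroup.exists_reiter (hG : IsAmenableGroup G) (E : Finset G) {ε : ℝ} (hε : 0 < ε) :
    ∃ p : G →₀ ℝ, (∀ g, 0 ≤ p g) ∧ (p.sum fun _ r => r) = 1 ∧
      ∀ s ∈ E, ∑' g, |p (s⁻¹ * g) - p g| < ε := by
  classical
  let d : G → (E → lp (fun _ : G => ℝ) 1) := fun g s =>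
    lp.single 1 ((s : G) * g) (1 : ℝ) - lp.single 1 g (1 : ℝ)
  set P : Set (E → lp (fun _ : G => ℝ) 1) := {q | ∃ p : G →₀ ℝ, (∀ g, 0 ≤ p g) ∧
    (p.sum fun _ r => r) = 1 ∧ ∀ (s : E) g, q s g = p ((s : G)⁻¹ * g) - p g} with hP
  have hsum : ∀ p q : G →₀ ℝ, ((p + q).sum fun _ r => r) =
      (p.sum fun _ r => r) + q.sum fun _ r => r :=
    fun p q => Finsupp.sum_add_index' (fun _ => rfl) fun _ _ _ => rfl
  have hPconv : Convex ℝ P := by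
    rintro x ⟨p, hp, hp1, hpx⟩ y ⟨q, hq, hq1, hqy⟩ a b ha hb hab
    refine ⟨a • p + b • q, fun g => ?_, ?_, fun s g => ?_⟩
    · have := hp g; have := hq g
      simp only [Finsupp.add_apply, Finsupp.smul_apply, smul_eq_mul]
      positivity
    · rw [hsum, Finsupp.sum_smul_index fun _ => rfl, Finsupp.sum_smul_index fun _ => rfl,
        ← Finsupp.mul_sum, ← Finsupp.mul_sum, hp1, hq1, mul_one, mul_one, hab]
    · change a * x s g + b * y s g = _
      rw [hpx, hqy]
      simp only [Finsupp.add_apply, Finsupp.smul_apply, smul_eq_mul]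
      ring
  have hPd : Set.range d ⊆ P := by
    rintro _ ⟨g, rfl⟩
    refine ⟨Finsupp.single g 1, fun h => ?_, ?_, fun s h => ?_⟩
    · rw [Finsupp.single_apply]; split_ifs <;> norm_num
    · rw [Finsupp.sum_single_index rfl]
    · change lp.single (E := fun _ : G => ℝ) 1 ((s : G) * g) (1 : ℝ) h -
        lp.single (E := fun _ : G => ℝ) 1 g (1 : ℝ) h = _
      rw [lp.single_apply, lp.single_apply, Finsupp.single_apply, Finsupp.single_apply,
        Pi.single_apply, Pi.single_apply]
      simp only [eq_comm (a := h), eq_inv_mul_iff_mul_eq]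
  -- Convexity argument: otherwise a functional separates 0 strictly from all tuples (δ_{sg} −
  -- δ_g)_s. Its values on point masses are bounded functions on G, and the separation contradicts
  -- the invariant mean.
  have h0 : (0 : E → lp (fun _ : G => ℝ) 1) ∈ closure (convexHull ℝ (Set.range d)) := by
    by_contra hnot
    obtain ⟨f, c, hc0, hc⟩ := geometric_hahn_banach_point_closed
      (convex_convexHull ℝ (Set.range d)).closure isClosed_closure hnot
    rw [map_zero] at hc0
    -- The value 0 outside E is a mere default, as only s in E are summed.
    let φ : G → G → ℝ := fun s g =>
      if hs : s ∈ E then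
        f (Pi.single ⟨s, hs⟩ (lp.single (E := fun _ : G => ℝ) 1 g (1 : ℝ))) else 0
    have hφ : ∀ s g, |φ s g| ≤ ‖f‖ := by
      intro s g
      by_cases hs : s ∈ E
      · simp only [φ, hs, dif_pos]
        refine (f.le_opNorm _).trans (mul_le_of_le_one_right (norm_nonneg _) ?_)
        rw [Pi.norm_single, lp.norm_single one_pos, norm_one]
      · simp [φ, hs]
    refine hG.not_forall_lt_sum E φ ‖f‖ hφ hc0 fun g => ?_
    refine (hc (d g) (subset_closure (subset_convexHull ℝ _ ⟨g, rfl⟩))).trans_eq ?_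
    rw [← Finset.univ_sum_single (d g), map_sum, ← Finset.sum_coe_sort E]
    refine Finset.sum_congr rfl fun s _ => ?_
    simp only [φ, s.2, dif_pos, d]
    rw [Pi.single_sub, map_sub]
  obtain ⟨q, hq, hqε⟩ := Metric.mem_closure_iff.1 h0 ε hε
  obtain ⟨p, hp, hp1, hpq⟩ := convexHull_min hPd hPconv hq
  refine ⟨p, hp, hp1, fun s hs => ?_⟩
  rw [dist_zero_left] at hqε
  refine lt_of_eq_of_lt ?_ ((norm_le_pi_norm q ⟨s, hs⟩).trans_lt hqε)
  rw [lp.norm_eq_tsum_rpow (by norm_num)]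
  simp [hpq]

/-! ### The regular representation and almost invariant vectors -/

theorem memℓp_leftTranslate (s : G) (f : lp (fun _ : G => ℂ) 2) :
    Memℓp (fun g : G => f (s⁻¹ * g)) 2 := by
  have hf := lp.memℓp f
  rw [memℓp_gen_iff (by norm_num)] at hf ⊢
  exact (Equiv.mulLeft s⁻¹).summable_iff.2 hf

/-- Left translation on `ℓ²(G)` as a linear isometry. -/
noncomputable def leftTranslate (s : G) : lp (fun _ : G => ℂ) 2 →ₗᵢ[ℂ] lp (fun _ : G => ℂ) 2 where
  toFun f := ⟨fun g => f (s⁻¹ * g), memℓp_leftTranslate s f⟩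
  map_add' f g := rfl
  map_smul' c f := rfl
  norm_map' f := by
    rw [lp.norm_eq_tsum_rpow (by norm_num), lp.norm_eq_tsum_rpow (by norm_num)]
    congr 1
    exact (Equiv.mulLeft s⁻¹).tsum_eq fun g => ‖f g‖ ^ (2 : ℝ≥0∞).toReal

theorem leftTranslate_apply (s g : G) (f : lp (fun _ : G => ℂ) 2) :
    leftTranslate s f g = f (s⁻¹ * g) := rfl

variable (G) in
/-- The left regular representation on `ℓ²(G)`. -/
noncomputable def leftRegular : G →* (lp (fun _ : G => ℂ) 2 ≃ₗᵢ[ℂ] lp (fun _ : G => ℂ) 2) where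
  toFun s :=
    { toLinearEquiv := LinearEquiv.ofLinearMap (leftTranslate s).toLinearMap
        (leftTranslate s⁻¹).toLinearMap
        (by ext f g; simp [leftTranslate_apply])
        (by ext f g; simp [leftTranslate_apply])
      norm_map' := (leftTranslate s).norm_map }
  map_one' := by
    ext f g
    change leftTranslate 1 f g = f g
    simp [leftTranslate_apply]
  map_mul' s t := by
    ext f g
    change leftTranslate (s * t) f g = leftTranslate s (leftTranslate t f) g
    simp [leftTranslate_apply, mul_assoc]

theorem leftRegular_apply (s g : G) (f : lp (fun _ : G => ℂ) 2) :
    leftRegular G s f g = f (s⁻¹ * g) := rfl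

/-- Turns ℓ¹ almost invariance of p into ℓ² almost invariance of √p, since |√a − √b| ≤ √a + √b. -/
theorem abs_sqrt_sub_sqrt_sq_le {a b : ℝ} (ha : 0 ≤ a) (hb : 0 ≤ b) :
    |√a - √b| ^ 2 ≤ |a - b| := by
  have h1 : |√a - √b| ≤ |√a + √b| := by
    rw [abs_of_nonneg (add_nonneg (Real.sqrt_nonneg a) (Real.sqrt_nonneg b)), abs_le]
    constructor <;> linarith [Real.sqrt_nonneg a, Real.sqrt_nonneg b]
  calc |√a - √b| ^ 2 ≤ |√a - √b| * |√a + √b| := by rw [sq]; gcongr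
    _ = |a - b| := by
      rw [← abs_mul]
      congr 1
      nlinarith [Real.mul_self_sqrt ha, Real.mul_self_sqrt hb]

/-- Finitely supported almost invariant unit vectors in `ℓ²(G)`. -/
theorem IsAmenableGroup.exists_almost_invariant (hG : IsAmenableGroup G) (E : Finset G) {ε : ℝ}
    (hε : 0 < ε) : ∃ ξ : lp (fun _ : G => ℂ) 2, (Function.support ξ).Finite ∧ ‖ξ‖ = 1 ∧
      ∀ s ∈ E, ‖leftRegular G s ξ - ξ‖ < ε := by
  -- The vector is √p, whose squared displacement is bounded by the ℓ¹ displacement of p; hence the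
  -- tolerance ε².
  obtain ⟨p, hp, hp1, hpE⟩ := hG.exists_reiter E (ε := ε ^ 2) (by positivity)
  have hsupp : (Function.support fun g => (√(p g) : ℂ)).Finite := by
    refine p.hasFiniteSupport.subset fun g hg hpg => hg ?_
    simp [show p g = 0 from hpg]
  have hmem : Memℓp (fun g => (√(p g) : ℂ)) 2 := by
    refine memℓp_gen (summable_of_hasFiniteSupport (hsupp.subset fun g hg hg0 => hg ?_))
    simp [show (√(p g) : ℂ) = 0 from hg0]
  have hnorm : ∀ f : lp (fun _ : G => ℂ) 2, ‖f‖ ^ 2 = ∑' g, ‖f g‖ ^ 2 := fun f => by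
    have := lp.norm_rpow_eq_tsum (p := 2) (by norm_num) f
    simpa using this
  refine ⟨⟨_, hmem⟩, hsupp, ?_, fun s hs => ?_⟩
  · rw [← sq_eq_sq₀ (norm_nonneg _) zero_le_one, hnorm, one_pow, ← hp1, Finsupp.sum,
      tsum_eq_sum (s := p.support)]
    · refine Finset.sum_congr rfl fun g _ => ?_
      change ‖(√(p g) : ℂ)‖ ^ 2 = _
      rw [Complex.norm_real, Real.norm_of_nonneg (Real.sqrt_nonneg _), Real.sq_sqrt (hp g)]
    · intro g hg
      change ‖(√(p g) : ℂ)‖ ^ 2 = _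
      rw [Finsupp.notMem_support_iff] at hg
      simp [hg]
  · rw [← sq_lt_sq₀ (norm_nonneg _) hε.le, hnorm]
    refine lt_of_le_of_lt ?_ (hpE s hs)
    have hpt : ∀ g, ‖(leftRegular G s ⟨_, hmem⟩ - ⟨_, hmem⟩ : lp (fun _ : G => ℂ) 2) g‖ ^ 2 ≤
        |p (s⁻¹ * g) - p g| := by
      intro g
      change ‖(√(p (s⁻¹ * g)) : ℂ) - (√(p g) : ℂ)‖ ^ 2 ≤ _
      rw [← Complex.ofReal_sub, Complex.norm_real]
      exact abs_sqrt_sub_sqrt_sq_le (hp _) (hp _)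
    have hfin : (Function.support fun g => |p (s⁻¹ * g) - p g|).Finite := by
      refine ((p.hasFiniteSupport.preimage (mul_right_injective s⁻¹).injOn).union
        p.hasFiniteSupport).subset fun g hg => ?_
      by_contra hnot
      simp only [Set.mem_union, Set.mem_preimage, Function.mem_support, not_or, not_not] at hnot
      exact hg (by simp [hnot.1, hnot.2])
    have hsum : Summable fun g => |p (s⁻¹ * g) - p g| := summable_of_hasFiniteSupport hfin
    exact (Summable.of_nonneg_of_le (fun _ => by positivity) hpt hsum).tsum_le_tsum hpt hsum

/-- The coefficient of a vector is a coefficient of the universal representation for a vector of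
the same norm. -/
theorem exists_univ_vector {K : Type u} [NormedAddCommGroup K] [InnerProductSpace ℂ K]
    [CompleteSpace K] (π : G →* (K ≃ₗᵢ[ℂ] K)) (ξ : K) :
    ∃ ζ : UnivSpace G, ‖ζ‖ = ‖ξ‖ ∧ ∀ s, ⟪ζ, univOp s ζ⟫_ℂ = ⟪ξ, π s ξ⟫_ℂ := by
  classical
  obtain ⟨σ, V, ξ₀, hξ, hV⟩ := exists_cyclicRep π ξ
  refine ⟨lp.single 2 σ ξ₀, ?_, fun s => ?_⟩
  · rw [lp.norm_single (by norm_num), ← hξ, V.norm_map]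
  · rw [inner_single_univOp, ← V.inner_map_map, hV, hξ]

theorem norm_coeffL_le {E : Type*} [NormedAddCommGroup E] [InnerProductSpace ℂ E] (ξ η : E) :
    ‖coeffL ξ η‖ ≤ ‖η‖ * ‖ξ‖ :=
  ContinuousLinearMap.opNorm_le_bound _ (by positivity) fun T => by
    rw [coeffL_apply]
    refine (norm_inner_le_norm _ _).trans ?_
    rw [mul_assoc, mul_comm ‖ξ‖]
    gcongr
    exact T.le_opNorm ξ

/-- Pointwise convergence of vector states on `G` implies convergence on `C*(G)`. -/
theorem tendsto_coeff {ι : Type*} {l : Filter ι} (ζ : ι → UnivSpace G) (ζ₀ : UnivSpace G)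
    (hζ : ∀ i, ‖ζ i‖ = 1)
    (h : ∀ s, Tendsto (fun i => ⟪ζ i, univOp s (ζ i)⟫_ℂ) l (𝓝 ⟪ζ₀, univOp s ζ₀⟫_ℂ))
    {x : UnivSpace G →L[ℂ] UnivSpace G} (hx : x ∈ fullCStar G) :
    Tendsto (fun i => ⟪ζ i, x (ζ i)⟫_ℂ) l (𝓝 ⟪ζ₀, x ζ₀⟫_ℂ) := by
  -- Unit vectors give contractive functionals, so the family is equicontinuous and convergence
  -- passes from the span of ϖ(G) to its closure.
  have hlip : ∀ i, LipschitzWith 1 (coeffL (ζ i) (ζ i)) := fun i =>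
    (coeffL (ζ i) (ζ i)).lipschitz.weaken (by
      rw [← NNReal.coe_le_coe]
      simpa [hζ i] using norm_coeffL_le (ζ i) (ζ i))
  have heq := (LipschitzWith.uniformEquicontinuous _ 1 hlip).equicontinuous
  have hx' : x ∈ closure (Submodule.span ℂ (Set.range (univOp (G := G))) :
      Set (UnivSpace G →L[ℂ] UnivSpace G)) := hx
  refine (heq x).tendsto_of_mem_closure (f := coeffL ζ₀ ζ₀)
    ((coeffL ζ₀ ζ₀).continuous.tendsto' _ _ rfl |>.mono_left inf_le_left) (fun y hy => ?_) hx'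
  induction hy using Submodule.span_induction with
  | mem y hy => obtain ⟨s, rfl⟩ := hy; exact h s
  | zero => simpa only [map_zero] using tendsto_const_nhds
  | add y z _ _ hy hz => simpa only [map_add] using hy.add hz
  | smul c y _ hy => simpa only [map_smul] using hy.const_smul c

/-- The trivial representation gives the unit of `B(G)`. -/
theorem exists_fourierStieltjes_one : ∃ (w : FourierStieltjes G) (ζ : UnivSpace G),
    (∀ s, w s = 1) ∧ ∀ s, ⟪ζ, univOp s ζ⟫_ℂ = w s := by
  obtain ⟨ζ, -, h⟩ := exists_univ_vector (K := EuclideanSpace ℂ PUnit.{u + 1}) (1 : G →* _)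
    (EuclideanSpace.single PUnit.unit 1)
  have h1 : ∀ s : G, (1 : ℂ) =
      ⟪(EuclideanSpace.single PUnit.unit 1 : EuclideanSpace ℂ PUnit.{u + 1}),
      (1 : G →* (EuclideanSpace ℂ PUnit.{u + 1} ≃ₗᵢ[ℂ] EuclideanSpace ℂ PUnit.{u + 1})) s
        (EuclideanSpace.single PUnit.unit 1)⟫_ℂ := by
    intro s
    rw [MonoidHom.one_apply]
    simp
  exact ⟨⟨fun _ => 1, _, _, _, inferInstance, 1, _, _, h1⟩, ζ, fun _ => rfl,
    fun s => (h s).trans (h1 s).symm⟩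

/-- The unit of `B(G)` is a weak* limit of finitely supported functions. -/
theorem IsAmenableGroup.exists_tendsto_one (hG : IsAmenableGroup G) :
    ∃ (w : Finset G × ℕ → FourierStieltjes G) (w₀ : FourierStieltjes G),
      (∀ i, (Function.support (w i)).Finite) ∧ (∀ s, w₀ s = 1) ∧ Tendsto w atTop (𝓝 w₀) := by
  obtain ⟨w₀, ζ₀, hw₀, hζ₀⟩ := exists_fourierStieltjes_one (G := G)
  -- The index records the finite set to be nearly fixed and the tolerance 1/(n+1).
  choose ξ hfin hnorm hinv using fun i : Finset G × ℕ =>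
    hG.exists_almost_invariant i.1 (ε := 1 / ((i.2 : ℝ) + 1)) (by positivity)
  choose ζ hζn hζ using fun i => exists_univ_vector (leftRegular G) (ξ i)
  let w : Finset G × ℕ → FourierStieltjes G := fun i =>
    ⟨fun s => ⟪ξ i, leftRegular G s (ξ i)⟫_ℂ, _, _, _, inferInstance, leftRegular G, ξ i, ξ i,
      fun _ => rfl⟩
  have hw : ∀ i s, w i s = ⟪ζ i, univOp s (ζ i)⟫_ℂ := fun i s => (hζ i s).symm
  refine ⟨w, w₀, fun i => ?_, hw₀, ?_⟩
  · refine (((hfin i).prod (hfin i)).image fun x => x.1 * x.2⁻¹).subset fun s hs => ?_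
    by_contra hnot
    refine hs ?_
    change ⟪ξ i, leftRegular G s (ξ i)⟫_ℂ = 0
    rw [lp.inner_eq_tsum]
    refine (tsum_congr fun g => ?_).trans tsum_zero
    rw [leftRegular_apply]
    by_cases h1 : ξ i g = 0
    · rw [h1, inner_zero_left]
    by_cases h2 : ξ i (s⁻¹ * g) = 0
    · rw [h2, inner_zero_right]
    exact absurd ⟨(g, s⁻¹ * g), ⟨h1, h2⟩, by simp⟩ hnot
  · rw [(Topology.IsInducing.mk rfl : Topology.IsInducing
      fun (v : FourierStieltjes G) (a : fullCStar G) => v.toDual a).tendsto_nhds_iff,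
      tendsto_pi_nhds]
    intro x
    change Tendsto (fun i => (w i).toDual x) _ _
    simp only [FourierStieltjes.toDual_eq_inner (hw _),
      FourierStieltjes.toDual_eq_inner fun s => (hζ₀ s).symm]
    refine tendsto_coeff ζ ζ₀ (fun i => (hζn i).trans (hnorm i)) (fun s => ?_) x.2
    simp only [hζ, hζ₀, hw₀]
    have hlim : Tendsto (fun i : Finset G × ℕ => 1 / ((i.2 : ℝ) + 1)) atTop (𝓝 0) :=
      tendsto_one_div_add_atTop_nhds_zero_nat.comp
        (prod_atTop_atTop_eq (α := Finset G) (β := ℕ) ▸ tendsto_snd)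
    refine tendsto_iff_norm_sub_tendsto_zero.2 (squeeze_zero' (Eventually.of_forall fun _ =>
      norm_nonneg _) ?_ hlim)
    filter_upwards [eventually_ge_atTop (({s} : Finset G), 0)] with i hi
    have hs : s ∈ i.1 := Finset.singleton_subset_iff.1 hi.1
    have h1 : ⟪ξ i, leftRegular G s (ξ i)⟫_ℂ - 1 = ⟪ξ i, leftRegular G s (ξ i) - ξ i⟫_ℂ := by
      rw [inner_sub_right, inner_self_eq_norm_sq_to_K, hnorm]
      simp
    rw [h1]
    refine (norm_inner_le_norm _ _).trans ?_
    rw [hnorm, one_mul]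
    exact (hinv i s hs).le

end Amenability

/-! ### Vector functionals on generated von Neumann algebras -/

section VectorFunctionals

/-- Invariance of M under the adjoint D' makes D preserve the orthogonal complement, so M reduces D.
-/
theorem commute_starProjection {K : Type*} [NormedAddCommGroup K] [InnerProductSpace ℂ K]
    (M : Submodule ℂ K) [M.HasOrthogonalProjection] (D D' : K →L[ℂ] K)
    (hadj : ∀ x y, ⟪x, D y⟫_ℂ = ⟪D' x, y⟫_ℂ) (hD : ∀ x ∈ M, D x ∈ M) (hD' : ∀ x ∈ M, D' x ∈ M)
    (y : K) : M.starProjection (D y) = D (M.starProjection y) := by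
  refine Submodule.eq_starProjection_of_mem_orthogonal
    (hD _ (Submodule.starProjection_apply_mem _ _)) ?_
  rw [← map_sub, Submodule.mem_orthogonal]
  intro m hm
  rw [hadj]
  exact M.sub_starProjection_mem_orthogonal y _ (hD' m hm)

section Diagonal

variable {H : Type*} [NormedAddCommGroup H] [InnerProductSpace ℂ H]

/-- The diagonal operator `x ⊕ x` on `H ⊕ H`. -/
noncomputable def diagOp (x : H →L[ℂ] H) : WithLp 2 (H × H) →L[ℂ] WithLp 2 (H × H) :=
  ((WithLp.prodContinuousLinearEquiv 2 ℂ H H).symm : H × H →L[ℂ] WithLp 2 (H × H)).comp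
    ((x.prodMap x).comp
      (WithLp.prodContinuousLinearEquiv 2 ℂ H H : WithLp 2 (H × H) →L[ℂ] H × H))

theorem diagOp_apply (x : H →L[ℂ] H) (v : WithLp 2 (H × H)) :
    diagOp x v = WithLp.toLp 2 (x v.fst, x v.snd) := rfl

end Diagonal

variable {H : Type*} [NormedAddCommGroup H] [InnerProductSpace ℂ H] [CompleteSpace H]

/-- An operator commuting with all `g`, for `g` in the commutant, commutes on the diagonal with
the projections commuting with a generating family. -/
theorem diagOp_commute {Γ : Type*} {U : Γ → H →L[ℂ] H} {T : H →L[ℂ] H}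
    (hT : T ∈ vonNeumannGenerated (Set.range U)) (P : WithLp 2 (H × H) →L[ℂ] WithLp 2 (H × H))
    (hP : ∀ γ y, P (diagOp (U γ) y) = diagOp (U γ) (P y))
    (hP' : ∀ γ y, P (diagOp (star (U γ)) y) = diagOp (star (U γ)) (P y)) (y : WithLp 2 (H × H)) :
    P (diagOp T y) = diagOp T (P y) := by
  let e := WithLp.prodContinuousLinearEquiv 2 ℂ H H
  let Q : H × H →L[ℂ] H × H := (e : WithLp 2 (H × H) →L[ℂ] H × H).comp
    (P.comp (e.symm : H × H →L[ℂ] WithLp 2 (H × H)))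
  have hQ : ∀ x : H →L[ℂ] H, (∀ y, P (diagOp x y) = diagOp x (P y)) →
      ∀ a b, Q (x a, x b) = (x (Q (a, b)).1, x (Q (a, b)).2) := by
    intro x hx a b
    have := congrArg e (hx (WithLp.toLp 2 (a, b)))
    exact this
  -- Each of the four matrix entries of Q commutes with every U γ and its adjoint, hence with T.
  have hentry : ∀ (q : H × H →L[ℂ] H) (j : H →L[ℂ] H × H),
      (∀ x : H →L[ℂ] H, (∀ a b, Q (x a, x b) = (x (Q (a, b)).1, x (Q (a, b)).2)) →
        ∀ a, q (Q (j (x a))) = x (q (Q (j a)))) → ∀ a, q (Q (j (T a))) = T (q (Q (j a))) := by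
    intro q j h a
    have hc := mem_vonNeumannGenerated_iff.1 hT (q.comp (Q.comp j)) ?_ ?_
    · exact congrArg (fun f => f a) hc
    · rintro _ ⟨γ, rfl⟩
      ext b
      exact (h _ (hQ _ (hP γ)) b).symm
    · rintro _ ⟨γ, rfl⟩
      ext b
      exact (h _ (hQ _ (hP' γ)) b).symm
  have hinl : ∀ x : H →L[ℂ] H, (∀ a b, Q (x a, x b) = (x (Q (a, b)).1, x (Q (a, b)).2)) →
      ∀ a, Q (x a, 0) = (x (Q (a, 0)).1, x (Q (a, 0)).2) := fun x hx a => by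
    simpa using hx a 0
  have hinr : ∀ x : H →L[ℂ] H, (∀ a b, Q (x a, x b) = (x (Q (a, b)).1, x (Q (a, b)).2)) →
      ∀ a, Q (0, x a) = (x (Q (0, a)).1, x (Q (0, a)).2) := fun x hx a => by
    simpa using hx 0 a
  have h11 := hentry (.fst ℂ H H) (.inl ℂ H H) fun x hx a => congrArg Prod.fst (hinl x hx a)
  have h12 := hentry (.fst ℂ H H) (.inr ℂ H H) fun x hx a => congrArg Prod.fst (hinr x hx a)
  have h21 := hentry (.snd ℂ H H) (.inl ℂ H H) fun x hx a => congrArg Prod.snd (hinl x hx a)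
  have h22 := hentry (.snd ℂ H H) (.inr ℂ H H) fun x hx a => congrArg Prod.snd (hinr x hx a)
  have hsplit : ∀ a b, Q (a, b) = Q (a, 0) + Q (0, b) := fun a b => by
    rw [← map_add, Prod.mk_add_mk, add_zero, zero_add]
  have hfinal : ∀ a b, Q (T a, T b) = (T (Q (a, b)).1, T (Q (a, b)).2) := by
    intro a b
    rw [hsplit (T a), hsplit a]
    refine Prod.ext ?_ ?_
    · exact (congrArg₂ (· + ·) (h11 a) (h12 b)).trans (map_add T _ _).symm
    · exact (congrArg₂ (· + ·) (h21 a) (h22 b)).trans (map_add T _ _).symm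
  exact congrArg e.symm (hfinal y.fst y.snd)

/-- Vector functionals that agree on a group of unitaries agree on the von Neumann algebra that it
generates. -/
theorem inner_eq_of_mem_vonNeumannGenerated {Γ : Type*} [Group Γ] {U : Γ → H →L[ℂ] H}
    (hone : U 1 = 1) (hmul : ∀ γ δ, U (γ * δ) = U γ * U δ) (hstar : ∀ γ, star (U γ) = U γ⁻¹)
    {T : H →L[ℂ] H} (hT : T ∈ vonNeumannGenerated (Set.range U)) {ξ η ξ' η' : H}
    (h : ∀ γ, ⟪η, U γ ξ⟫_ℂ = ⟪η', U γ ξ'⟫_ℂ) : ⟪η, T ξ⟫_ℂ = ⟪η', T ξ'⟫_ℂ := by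
  -- Amplification by two: M is the cyclic subspace of ξ ⊕ ξ' under U ⊕ U. Its projection commutes
  -- with T ⊕ T, so (T ⊕ T)v stays in M, while pairing with η ⊕ (−η') annihilates M by hypothesis.
  set v : WithLp 2 (H × H) := WithLp.toLp 2 (ξ, ξ') with hv
  set D : Set (WithLp 2 (H × H)) := Set.range fun γ => diagOp (U γ) v with hD
  set M : Submodule ℂ (WithLp 2 (H × H)) := (Submodule.span ℂ D).topologicalClosure with hM
  have hMc : IsClosed (M : Set (WithLp 2 (H × H))) := Submodule.isClosed_topologicalClosure _
  have : CompleteSpace M := hMc.completeSpace_coe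
  have hinv : ∀ γ, ∀ x ∈ M, diagOp (U γ) x ∈ M := by
    intro γ x hx
    refine mem_of_mem_closure_span (diagOp (U γ)) hMc ?_ hx
    rintro _ ⟨δ, rfl⟩
    refine Submodule.le_topologicalClosure _ (Submodule.subset_span ⟨γ * δ, ?_⟩)
    simp only [diagOp_apply, hmul]
    rfl
  have hadj : ∀ γ (x y : WithLp 2 (H × H)),
      ⟪x, diagOp (U γ) y⟫_ℂ = ⟪diagOp (star (U γ)) x, y⟫_ℂ := by
    intro γ x y
    rw [WithLp.prod_inner_apply, WithLp.prod_inner_apply, ContinuousLinearMap.star_eq_adjoint]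
    exact congrArg₂ (· + ·) (ContinuousLinearMap.adjoint_inner_left _ _ _).symm
      (ContinuousLinearMap.adjoint_inner_left _ _ _).symm
  have hcomm : ∀ γ y, M.starProjection (diagOp (U γ) y) = diagOp (U γ) (M.starProjection y) :=
    fun γ => commute_starProjection M _ _ (hadj γ) (hinv γ) (by rw [hstar]; exact hinv γ⁻¹)
  have hTcomm :=
    diagOp_commute hT M.starProjection hcomm (fun γ => by rw [hstar]; exact hcomm γ⁻¹) v
  have hvM : v ∈ M := by
    refine Submodule.le_topologicalClosure _ (Submodule.subset_span ⟨1, ?_⟩)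
    simp only [hone]
    rfl
  have hTv : diagOp T v ∈ M := by
    rw [Submodule.starProjection_eq_self_iff.2 hvM] at hTcomm
    exact Submodule.starProjection_eq_self_iff.1 hTcomm
  have hzero := eq_of_mem_closure_span (innerSL ℂ (WithLp.toLp 2 (η, -η'))) 0 (D := D) ?_ hTv
  · have h1 : ⟪η, T ξ⟫_ℂ + ⟪-η', T ξ'⟫_ℂ = 0 := by
      rw [innerSL_apply_apply, WithLp.prod_inner_apply] at hzero
      exact hzero
    rwa [inner_neg_left, ← sub_eq_add_neg, sub_eq_zero] at h1
  · rintro _ ⟨γ, rfl⟩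
    have h1 : ⟪η, U γ ξ⟫_ℂ + ⟪-η', U γ ξ'⟫_ℂ = 0 := by
      rw [inner_neg_left, h γ, add_neg_cancel]
    rw [innerSL_apply_apply, WithLp.prod_inner_apply, zero_apply]
    exact h1

/-- V intertwines g with g' and W intertwines their adjoints, so commutation with g' descends to the
compression. -/
theorem sandwich_commute {K : Type*} [NormedAddCommGroup K] [InnerProductSpace ℂ K]
    [CompleteSpace K] {V W : H →L[ℂ] K} {T g' : K →L[ℂ] K} {g : H →L[ℂ] H}
    (hV : ∀ x, g' (V x) = V (g x)) (hW : ∀ x, star g' (W x) = W (star g x))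
    (hT : T * g' = g' * T) : g * sandwich V W T = sandwich V W T * g := by
  ext c
  refine ext_inner_left ℂ fun b => ?_
  rw [mul_apply_eq_comp, mul_apply_eq_comp, ← ContinuousLinearMap.adjoint_inner_left,
    inner_sandwich, inner_sandwich, ← ContinuousLinearMap.star_eq_adjoint, ← hW, ← hV,
    ContinuousLinearMap.star_eq_adjoint, ContinuousLinearMap.adjoint_inner_left,
    ← mul_apply_eq_comp, ← mul_apply_eq_comp, hT]

/-- For g in the commutant of M, 1 ⊗ g commutes with every generator x ⊗ y and so with a. Slicing
the first leg turns this into commutation with g, and the bicommutant property concludes. -/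
theorem leftSlice_mem {M : VonNeumannAlgebra H} {a : HilbertTensorSq H →L[ℂ] HilbertTensorSq H}
    (ha : a ∈ vonNeumannGenerated {T | ∃ x ∈ M, ∃ y ∈ M, T = opTmul x y}) (ξ η : H) :
    leftSlice ξ η a ∈ M := by
  rw [← M.commutant_commutant, VonNeumannAlgebra.mem_commutant_iff]
  intro g hg
  rw [VonNeumannAlgebra.mem_commutant_iff] at hg
  have hc : ∀ x : H →L[ℂ] H, ∀ y ∈ M, cmap x y * cmap 1 g = cmap 1 g * cmap x y := by
    intro x y hy
    rw [cmap_mul, cmap_mul, hg y hy, mul_one, one_mul]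
  have h := mem_vonNeumannGenerated_iff.1 ha (cmap 1 g) ?_ ?_
  · refine sandwich_commute (g' := cmap 1 g) (fun x => cmap_ctmul _ _ _ _) (fun x => ?_) h.symm
    rw [star_cmap, star_one]
    exact cmap_ctmul _ _ _ _
  · rintro _ ⟨x, -, y, hy, rfl⟩
    exact hc x y hy
  · rintro _ ⟨x, -, y, hy, rfl⟩
    rw [show opTmul x y = cmap x y from rfl, star_cmap]
    exact hc _ _ (star_mem hy)

theorem rightSlice_mem {M : VonNeumannAlgebra H} {a : HilbertTensorSq H →L[ℂ] HilbertTensorSq H}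
    (ha : a ∈ vonNeumannGenerated {T | ∃ x ∈ M, ∃ y ∈ M, T = opTmul x y}) (ξ η : H) :
    rightSlice ξ η a ∈ M := by
  rw [← M.commutant_commutant, VonNeumannAlgebra.mem_commutant_iff]
  intro g hg
  rw [VonNeumannAlgebra.mem_commutant_iff] at hg
  have hc : ∀ x ∈ M, ∀ y : H →L[ℂ] H, cmap x y * cmap g 1 = cmap g 1 * cmap x y := by
    intro x hx y
    rw [cmap_mul, cmap_mul, hg x hx, mul_one, one_mul]
  have h := mem_vonNeumannGenerated_iff.1 ha (cmap g 1) ?_ ?_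
  · refine sandwich_commute (g' := cmap g 1) (fun x => cmap_ctmul _ _ _ _) (fun x => ?_) h.symm
    rw [star_cmap, star_one]
    exact cmap_ctmul _ _ _ _
  · rintro _ ⟨x, hx, y, -, rfl⟩
    exact hc x hx y
  · rintro _ ⟨x, hx, y, -, rfl⟩
    rw [show opTmul x y = cmap x y from rfl, star_cmap]
    exact hc _ (star_mem hx) _

end VectorFunctionals

/-- Hahn–Banach separation: a norm-closed subspace is weakly closed. -/
theorem mem_of_tendsto_weak {E ι : Type*} [NormedAddCommGroup E] [NormedSpace ℂ E] {l : Filter ι}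
    [l.NeBot] {X : Submodule ℂ E} (hX : IsClosed (X : Set E)) {x : ι → E} {a : E}
    (hx : ∀ i, x i ∈ X)
    (h : ∀ F : StrongDual ℂ E, Filter.Tendsto (fun i => F (x i)) l (nhds (F a))) : a ∈ X := by
  by_contra hnot
  obtain ⟨F, c, hFa, hF⟩ := RCLike.geometric_hahn_banach_point_closed (𝕜 := ℂ)
    (X.restrictScalars ℝ).convex hX hnot
  have := ge_of_tendsto' ((Complex.continuous_re.tendsto _).comp (h F)) fun i => (hF _ (hx i)).le
  exact absurd hFa (not_lt.2 this)

/-! ### Elements with weakly continuous orbit maps -/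

theorem sandwich_mem_of_mem_closure_span {E K : Type*} [NormedAddCommGroup E]
    [InnerProductSpace ℂ E] [CompleteSpace E] [NormedAddCommGroup K] [InnerProductSpace ℂ K]
    [CompleteSpace K] {V W : E →L[ℂ] K} {D : Set (K →L[ℂ] K)} {M : Submodule ℂ (E →L[ℂ] E)}
    (hM : IsClosed (M : Set (E →L[ℂ] E))) (h : ∀ x ∈ D, sandwich V W x ∈ M) {x : K →L[ℂ] K}
    (hx : x ∈ (Submodule.span ℂ D).topologicalClosure) : sandwich V W x ∈ M :=
  mem_of_mem_closure_span _ hM h hx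

section Orbit

open Filter Topology

variable {G : Type u} [Group G]

theorem univOp_one : univOp (1 : G) = 1 := by
  ext f : 1
  change univRep G 1 f = f
  rw [map_one]
  rfl

theorem inner_eq_of_mem_groupWStar {T : UnivSpace G →L[ℂ] UnivSpace G} (hT : T ∈ groupWStar G)
    {ξ η ξ' η' : UnivSpace G} (h : ∀ s, ⟪η, univOp s ξ⟫_ℂ = ⟪η', univOp s ξ'⟫_ℂ) :
    ⟪η, T ξ⟫_ℂ = ⟪η', T ξ'⟫_ℂ :=
  inner_eq_of_mem_vonNeumannGenerated univOp_one univOp_mul star_univOp hT h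

variable (G) in
/-- The left regular representation provides an orthonormal orbit in the universal
representation. -/
theorem exists_orthonormal_orbit [DecidableEq G] : ∃ ζ : UnivSpace G, ∀ s t : G,
    ⟪univOp s ζ, univOp t ζ⟫_ℂ = if s = t then 1 else 0 := by
  obtain ⟨ζ, -, h⟩ := exists_univ_vector (leftRegular G) (lp.single 2 (1 : G) (1 : ℂ))
  refine ⟨ζ, fun s t => ?_⟩
  have h1 : ⟪univOp s ζ, univOp t ζ⟫_ℂ = ⟪ζ, univOp (s⁻¹ * t) ζ⟫_ℂ := by
    rw [← ContinuousLinearMap.adjoint_inner_right, ← ContinuousLinearMap.star_eq_adjoint,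
      star_univOp, univOp_mul, mul_apply_eq_comp]
  rw [h1, h, lp.inner_single_left, leftRegular_apply, lp.single_apply, Pi.single_apply]
  simp [inv_mul_eq_one, eq_comm]

theorem IsLeftAction.eq_of_one {w : FourierStieltjes G} (hw : ∀ s, w s = 1)
    {a b : (wStarTensor G).toSubspace} (h : IsLeftAction w a b) : b = a :=
  Subtype.ext (op_ext_hilbertTmul _ _ fun ξ₁ ξ₂ η₁ η₂ =>
    h _ _ _ _ _ _ fun s => by rw [hw, mul_one])

theorem IsRightAction.eq_of_one {w : FourierStieltjes G} (hw : ∀ s, w s = 1)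
    {a b : (wStarTensor G).toSubspace} (h : IsRightAction w a b) : b = a :=
  Subtype.ext (op_ext_hilbertTmul _ _ fun ξ₁ ξ₂ η₁ η₂ =>
    h _ _ _ _ _ _ fun s => by rw [hw, one_mul])

/-- If `1` is a limit of elements whose action sends `a` to a closed subspace, then `a` lies in that
subspace. -/
theorem mem_of_continuous_toWeakSpace {ι : Type*} {l : Filter ι} [l.NeBot]
    {w : ι → FourierStieltjes G} {w₀ : FourierStieltjes G} (hw : Tendsto w l (𝓝 w₀))
    {L : FourierStieltjes G → (wStarTensor G).toSubspace}
    (hL : Continuous (fun w => toWeakSpace ℂ (wStarTensor G).toSubspace (L w)))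
    {X : Submodule ℂ (HilbertTensorSq (UnivSpace G) →L[ℂ] HilbertTensorSq (UnivSpace G))}
    (hX : IsClosed (X : Set (HilbertTensorSq (UnivSpace G) →L[ℂ] HilbertTensorSq (UnivSpace G))))
    (hwX : ∀ i, (L (w i)).1 ∈ X) : (L w₀).1 ∈ X := by
  refine mem_of_tendsto_weak (l := l) hX hwX fun F => ?_
  have h := (WeakBilin.eval_continuous _ (F.comp (wStarTensor G).toSubspace.subtypeL)).comp hL
  exact (h.tendsto w₀).comp hw

variable [DecidableEq G] {ζ : UnivSpace G}

/-- A functional with finitely supported coefficient function is evaluated on the orthonormal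
orbit. -/
theorem inner_eq_sum (hζ : ∀ s t : G, ⟪univOp s ζ, univOp t ζ⟫_ℂ = if s = t then 1 else 0)
    {T : UnivSpace G →L[ℂ] UnivSpace G} (hT : T ∈ groupWStar G) {ξ η : UnivSpace G} {c : G → ℂ}
    {S : Finset G} (hc : ∀ s ∉ S, c s = 0) (h : ∀ s, ⟪η, univOp s ξ⟫_ℂ = c s) :
    ⟪η, T ξ⟫_ℂ = ∑ s ∈ S, c s * ⟪univOp s ζ, T ζ⟫_ℂ := by
  -- By orthonormality this single vector, paired with ζ, reproduces c on G. The conjugates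
  -- compensate for the conjugate-linear first slot.
  have hsum : ∀ x : UnivSpace G, ⟪∑ s ∈ S, (starRingEnd ℂ (c s)) • univOp s ζ, x⟫_ℂ =
      ∑ s ∈ S, c s * ⟪univOp s ζ, x⟫_ℂ := fun x => by
    rw [sum_inner]
    exact Finset.sum_congr rfl fun s _ => by rw [inner_smul_left, Complex.conj_conj]
  rw [← hsum]
  refine inner_eq_of_mem_groupWStar hT fun t => ?_
  rw [h, hsum]
  simp only [hζ, mul_ite, mul_one, mul_zero, Finset.sum_ite_eq']
  split_ifs with ht
  · rfl
  · exact hc t ht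

/-- A coefficient multiplied by w is supported where w is, so on the left slices of a, which lie in
W*(G), it is a finite combination of evaluations along the orthonormal orbit. Single summands are
used because there the product with w is known to be a coefficient of ϖ. -/
theorem IsLeftAction.eq_sum
    (hζ : ∀ s t : G, ⟪univOp s ζ, univOp t ζ⟫_ℂ = if s = t then 1 else 0)
    {w : FourierStieltjes G} (hw : (Function.support w).Finite)
    {a b : (wStarTensor G).toSubspace} (h : IsLeftAction w a b) :
    b.1 = ∑ t ∈ hw.toFinset, w t • cmap (rightSlice ζ (univOp t ζ) a.1) (univOp t) := by
  classical
  refine op_ext_single_right _ _ fun ξ₁ η₁ σ τ x y => ?_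
  obtain ⟨ξ', η', hξ⟩ := exists_mul_univ w σ τ x y
  rw [h _ _ _ _ _ _ hξ]
  refine (inner_leftSlice ξ₁ η₁ a.1 η' ξ').symm.trans ?_
  rw [inner_eq_sum hζ (leftSlice_mem a.2 ξ₁ η₁) (S := hw.toFinset) (fun s hs => ?_) hξ]
  · rw [sum_apply, inner_sum]
    refine Finset.sum_congr rfl fun t _ => ?_
    rw [smul_apply, inner_smul_right, inner_leftSlice]
    refine Eq.trans ?_ (congrArg (w t * ·) (congrArg (fun v => ⟪ctmul _ _, v⟫_ℂ)
      (cmap_ctmul _ _ _ _)).symm)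
    rw [inner_ctmul, inner_rightSlice]
    ring
  · rw [Set.Finite.mem_toFinset, Function.notMem_support] at hs
    rw [hs, mul_zero]

theorem IsRightAction.eq_sum
    (hζ : ∀ s t : G, ⟪univOp s ζ, univOp t ζ⟫_ℂ = if s = t then 1 else 0)
    {w : FourierStieltjes G} (hw : (Function.support w).Finite)
    {a b : (wStarTensor G).toSubspace} (h : IsRightAction w a b) :
    b.1 = ∑ t ∈ hw.toFinset, w t • cmap (univOp t) (leftSlice ζ (univOp t ζ) a.1) := by
  classical
  refine op_ext_single_left _ _ fun ξ₂ η₂ σ τ x y => ?_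
  obtain ⟨ξ', η', hξ⟩ := exists_mul_univ w σ τ x y
  rw [h _ _ _ _ _ _ fun s => (hξ s).trans (mul_comm _ _)]
  refine (inner_rightSlice ξ₂ η₂ a.1 η' ξ').symm.trans ?_
  rw [inner_eq_sum hζ (rightSlice_mem a.2 ξ₂ η₂) (S := hw.toFinset) (fun s hs => ?_) hξ]
  · rw [sum_apply, inner_sum]
    refine Finset.sum_congr rfl fun t _ => ?_
    rw [smul_apply, inner_smul_right, inner_rightSlice]
    refine Eq.trans ?_ (congrArg (w t * ·) (congrArg (fun v => ⟪ctmul _ _, v⟫_ℂ)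
      (cmap_ctmul _ _ _ _)).symm)
    rw [inner_ctmul, inner_leftSlice]
    ring
  · rw [Set.Finite.mem_toFinset, Function.notMem_support] at hs
    rw [hs, mul_zero]

theorem mem_minTensor_of_mem_cSigmaW (hG : IsAmenableGroup G) {a : (wStarTensor G).toSubspace}
    (ha : a ∈ cSigmaW G) : a.1 ∈ minTensor G := by
  obtain ⟨L, R, hL, hR, hLc, hRc⟩ := ha
  obtain ⟨w, w₀, hw, hw₀, hlim⟩ := hG.exists_tendsto_one
  obtain ⟨ζ, hζ⟩ := exists_orthonormal_orbit G
  -- The left action controls only the second leg, so the first leg may be any bounded operator at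
  -- this stage.
  set D : Set (HilbertTensorSq (UnivSpace G) →L[ℂ] HilbertTensorSq (UnivSpace G)) :=
    Set.range fun q : (UnivSpace G →L[ℂ] UnivSpace G) × G => cmap q.1 (univOp q.2) with hD
  have haD : a.1 ∈ (Submodule.span ℂ D).topologicalClosure := by
    have := mem_of_continuous_toWeakSpace hlim hLc
      (Submodule.isClosed_topologicalClosure (Submodule.span ℂ D)) fun i => ?_
    · rwa [(hL w₀).eq_of_one hw₀] at this
    · rw [(hL (w i)).eq_sum hζ (hw i)]
      exact Submodule.sum_mem _ fun t _ => Submodule.smul_mem _ _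
        (Submodule.le_topologicalClosure _ (Submodule.subset_span ⟨(_, t), rfl⟩))
  have hslice : ∀ ξ η, leftSlice ξ η a.1 ∈ fullCStar G := by
    intro ξ η
    refine sandwich_mem_of_mem_closure_span (V := ctmulL ξ) (W := ctmulL η)
      (Submodule.isClosed_topologicalClosure _) ?_ haD
    rintro _ ⟨q, rfl⟩
    have h : sandwich (ctmulL ξ) (ctmulL η) (cmap q.1 (univOp q.2)) =
      ⟪η, q.1 ξ⟫_ℂ • univOp q.2 := leftSlice_cmap ξ η q.1 (univOp q.2)
    rw [h]
    exact Submodule.smul_mem _ _ (univOp_mem_fullCStar _)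
  -- With left slices now in C*(G), the terms ϖ(t) ⊗ y_t of the right action have both legs in
  -- C*(G).
  have := mem_of_continuous_toWeakSpace hlim hRc
    (X := minTensor G) (Submodule.isClosed_topologicalClosure _) fun i => ?_
  · rwa [(hR w₀).eq_of_one hw₀] at this
  · rw [(hR (w i)).eq_sum hζ (hw i)]
    exact Submodule.sum_mem _ fun t _ => Submodule.smul_mem _ _
      (Submodule.le_topologicalClosure _
        (Submodule.subset_span ⟨_, univOp_mem_fullCStar t, _, hslice _ _, rfl⟩))

end Orbit

theorem proposition5p1 (G : Type*) [Group G] (hG : IsAmenableGroup G) :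
    (fun a : (wStarTensor G).toSubspace =>
      (a : HilbertTensorSq (UnivSpace G) →L[ℂ] HilbertTensorSq (UnivSpace G))) '' cSigmaW G =
      (minTensor G : Set (HilbertTensorSq (UnivSpace G) →L[ℂ] HilbertTensorSq (UnivSpace G))) := by
  classical
  ext a
  constructor
  · rintro ⟨a, ha, rfl⟩
    exact mem_minTensor_of_mem_cSigmaW hG ha
  · intro ha
    exact ⟨_, mem_cSigmaW_of_mem_minTensor ha, rfl⟩
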